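/- **Theorem 2.** Consider the finite-horizon Bayesian multi-armed bandit problem with instantaneous feedback. There are $n$ independent arms and a horizon of $T$ plays. Arm $i$ has a hidden parameter $\theta_i$, drawn from a known, arbitrary prior, independently of the other arms. Given $\theta_i$, the plays of arm $i$ have i.i.d. nonnegative outcomes with distribution $D_i=D_i(\theta_i)$, and the outcome is observed immediately after each play. Arm $i$ has a budget $B_i\in[0,\infty]$: a play with outcome $y$ accrues the reward $\min(y,b)$, where $b$ is the part of the budget left before the play, and the budget left afterwards is $\max(b-y,0)$. Each arm has a finite state space $S_i$. Its initial state carries the prior and the full budget; every state carries a posterior distribution of $\theta_i$ and a remaining budget; and the state after a play is a function of the state before it and of the outcome, according to Bayes' rule and the budget rule, for every state in which the arm can be played within the horizon. The expected reward of a play is assumed to be finite in every such state. A policy decides, from the current states of all arms and the numbers of plays they have received, which arm to play next or to quit; $\mathrm{OPT}$ is the supremum, over all policies, of the expected total reward accrued in at most $T$ plays. The input consists of $T$, $n$, the sizes $|S_i|$, the initial states, the transition probabilities between the states of each arm, and the expected reward accrued by a play in each state. Running time is counted in unit-cost operations (memory accesses, addition and subtraction of indices, exact arithmetic operations and comparisons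 of real numbers). Then there are an algorithm that, in time $\mathrm{poly}(T,\sum_i|S_i|)$, computes from the input a description of a policy with expected total reward at least $\tfrac12\,\mathrm{OPT}$, and an algorithm that, in time $\mathrm{poly}(T,\sum_i|S_i|)$ per decision, computes from this description the decisions of the policy in the positions that occur within the horizon. -/

import Mathlib

open MeasureTheory ProbabilityTheory
open scoped NNReal ENNReal

universe u

namespace BayesBandit

/-! ## Computation: a real RAM

Programs of a while language over finitely many (statically named) unbounded arrays of natural
numbers and of real numbers, with indirect addressing. Every operation costs one step: constants,
array accesses, addition and truncated subtraction of natural numbers (no multiplication), field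
operations on reals, comparisons, assignments and tests. -/

/-- The memory: cell `j` of the natural-number array `a` and of the real array `a`. -/
structure Store where
  nat : ℕ → ℕ → ℕ
  real : ℕ → ℕ → ℝ

inductive NatExpr where
  | lit (m : ℕ)
  | get (a : ℕ) (i : NatExpr)
  | add (e f : NatExpr)
  | sub (e f : NatExpr)

namespace NatExpr

def eval (s : Store) : NatExpr → ℕ
  | lit m => m
  | get a i => s.nat a (i.eval s)
  | add e f => e.eval s + f.eval s
  | sub e f => e.eval s - f.eval s

/-- The number of steps of an evaluation. -/
def cost : NatExpr → ℕ
  | lit _ => 1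
  | get _ i => i.cost + 1
  | add e f => e.cost + f.cost + 1
  | sub e f => e.cost + f.cost + 1

end NatExpr

inductive RealExpr where
  | lit (m : ℚ)
  | get (a : ℕ) (i : NatExpr)
  | add (e f : RealExpr)
  | sub (e f : RealExpr)
  | mul (e f : RealExpr)
  | div (e f : RealExpr)

namespace RealExpr

noncomputable def eval (s : Store) : RealExpr → ℝ
  | lit m => (m : ℝ)
  | get a i => s.real a (i.eval s)
  | add e f => e.eval s + f.eval s
  | sub e f => e.eval s - f.eval s
  | mul e f => e.eval s * f.eval s
  | div e f => e.eval s / f.eval s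

/-- The number of steps of an evaluation. -/
def cost : RealExpr → ℕ
  | lit _ => 1
  | get _ i => i.cost + 1
  | add e f => e.cost + f.cost + 1
  | sub e f => e.cost + f.cost + 1
  | mul e f => e.cost + f.cost + 1
  | div e f => e.cost + f.cost + 1

end RealExpr

inductive Test where
  | natLe (e f : NatExpr)
  | realLe (e f : RealExpr)
  | neg (b : Test)
  | conj (b c : Test)

namespace Test

def Holds (s : Store) : Test → Prop
  | natLe e f => e.eval s ≤ f.eval s
  | realLe e f => e.eval s ≤ f.eval s
  | neg b => ¬ b.Holds s
  | conj b c => b.Holds s ∧ c.Holds s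

/-- The number of steps of an evaluation. -/
def cost : Test → ℕ
  | natLe e f => e.cost + f.cost + 1
  | realLe e f => e.cost + f.cost + 1
  | neg b => b.cost + 1
  | conj b c => b.cost + c.cost + 1

end Test

namespace Store

/-- Write `v` into cell `j` of the natural-number array `a`. -/
def setNat (s : Store) (a j v : ℕ) : Store where
  nat := fun a' j' => if a' = a ∧ j' = j then v else s.nat a' j'
  real := s.real

/-- Write `v` into cell `j` of the real array `a`. -/
def setReal (s : Store) (a j : ℕ) (v : ℝ) : Store where
  nat := s.nat
  real := fun a' j' => if a' = a ∧ j' = j then v else s.real a' j'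

end Store

inductive Prog where
  | skip
  | assignNat (a : ℕ) (i e : NatExpr)
  | assignReal (a : ℕ) (i : NatExpr) (e : RealExpr)
  | seq (p q : Prog)
  | ite (b : Test) (p q : Prog)
  | loop (b : Test) (p : Prog)

/-- `p.Runs s s' c`: started on the memory `s`, the program `p` halts after exactly `c` steps
with the memory `s'`. -/
inductive Prog.Runs : Prog → Store → Store → ℕ → Prop
  | skip (s : Store) : Prog.Runs .skip s s 1
  | assignNat (a : ℕ) (i e : NatExpr) (s : Store) :
      Prog.Runs (.assignNat a i e) s (s.setNat a (i.eval s) (e.eval s)) (i.cost + e.cost + 1)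
  | assignReal (a : ℕ) (i : NatExpr) (e : RealExpr) (s : Store) :
      Prog.Runs (.assignReal a i e) s (s.setReal a (i.eval s) (e.eval s)) (i.cost + e.cost + 1)
  | seq {p q : Prog} {s s' s'' : Store} {c d : ℕ} :
      Prog.Runs p s s' c → Prog.Runs q s' s'' d → Prog.Runs (.seq p q) s s'' (c + d)
  | iteTrue {b : Test} {p q : Prog} {s s' : Store} {c : ℕ} :
      b.Holds s → Prog.Runs p s s' c → Prog.Runs (.ite b p q) s s' (b.cost + 1 + c)
  | iteFalse {b : Test} {p q : Prog} {s s' : Store} {c : ℕ} :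
      ¬ b.Holds s → Prog.Runs q s s' c → Prog.Runs (.ite b p q) s s' (b.cost + 1 + c)
  | loopDone {b : Test} {p : Prog} {s : Store} :
      ¬ b.Holds s → Prog.Runs (.loop b p) s s (b.cost + 1)
  | loopStep {b : Test} {p : Prog} {s s' s'' : Store} {c d : ℕ} :
      b.Holds s → Prog.Runs p s s' c → Prog.Runs (.loop b p) s' s'' d →
        Prog.Runs (.loop b p) s s'' (b.cost + 1 + c + d)

/-! ## Arms with priors, budgets and posterior spaces -/

/-- The data of one arm. A hidden parameter `θ : Θ` determines the distribution `law θ` of the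
(nonnegative) reward of a play; plays are i.i.d. given `θ`. The finite state space `Fin card`
records what has been learnt: state `u` stands for the posterior distribution `post u` of the
parameter together with the part `remaining u` of the budget that is left, and observing the
outcome `y` of a play in state `u` leads to the state `next u y`. -/
structure Arm where
  Θ : Type u
  [measurableSpace : MeasurableSpace Θ]
  [standardBorel : StandardBorelSpace Θ]
  [nonempty : Nonempty Θ]
  law : Kernel Θ ℝ≥0
  [markov : IsMarkovKernel law]
  card : ℕ
  root : Fin card
  post : Fin card → ProbabilityMeasure Θ
  remaining : Fin card → ℝ≥0∞
  next : Fin card → ℝ≥0 → Fin card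
  measurable_next : ∀ v, Measurable (next v)

attribute [instance] Arm.measurableSpace Arm.standardBorel Arm.nonempty Arm.markov

namespace Arm

variable (A : Arm.{u})

/-- The prior: the distribution of the parameter before any observation. -/
def prior : Measure A.Θ := (A.post A.root : Measure A.Θ)

/-- The budget: the maximum total reward that the arm can accrue (`∞` if there is no budget). -/
noncomputable def budget : ℝ≥0∞ := A.remaining A.root

/-- The distribution of the outcome of a play in state `v`. -/
noncomputable def outcome (v : Fin A.card) : Measure ℝ≥0 := A.law ∘ₘ (A.post v : Measure A.Θ)

/-- The expected reward accrued by a play in state `v`. The play accrues its outcome, as far as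
the remaining budget allows. -/
noncomputable def reward (v : Fin A.card) : ℝ≥0∞ :=
  ∫⁻ y, min (y : ℝ≥0∞) (A.remaining v) ∂(A.outcome v)

/-- The states that occur with positive probability after exactly `k` plays of the arm. -/
def Reach : ℕ → Fin A.card → Prop
  | 0, v => v = A.root
  | k + 1, w => ∃ v, Reach k v ∧ A.outcome v {y | A.next v y = w} ≠ 0

/-- The state space is the space of posteriors over a horizon of `T` plays: in every state in
which the arm can be played within the horizon, the next state carries the posterior given by
Bayes' rule (`law†μ` is Mathlib's posterior kernel for the prior `μ`) and the budget left after
the observed outcome (truncated subtraction), and the expected reward is finite. Nothing is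
required of the states that are only reached by the last play. -/
structure IsPosteriorSpace (T : ℕ) : Prop where
  bayes : ∀ k < T, ∀ v, A.Reach k v → ∀ᵐ y ∂(A.outcome v),
    (A.post (A.next v y) : Measure A.Θ) = (A.law†(A.post v : Measure A.Θ)) y
  budget : ∀ k < T, ∀ v, A.Reach k v → ∀ᵐ y ∂(A.outcome v),
    A.remaining (A.next v y) = A.remaining v - (y : ℝ≥0∞)
  finite : ∀ k < T, ∀ v, A.Reach k v → A.reward v ≠ ∞

end Arm

/-! ## The finite horizon bandit problem -/

/-- An instance of the finite horizon Bayesian bandit problem with instantaneous feedback. -/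
structure Instance where
  horizon : ℕ
  numArms : ℕ
  arm : Fin numArms → Arm.{u}
  isPosteriorSpace : ∀ i, (arm i).IsPosteriorSpace horizon

namespace Instance

variable (I : Instance.{u})

/-- The total number of states of all arms. -/
def totalStates : ℕ := ∑ i, (I.arm i).card

/-- The current state of each arm, with the number of plays that it has received so far. Since
the horizon is fixed, this determines the remaining horizon. -/
abbrev Position : Type := ∀ i, Fin (I.arm i).card × ℕ

/-- A decision policy: which arm to play in which position; `none` means to quit. -/
abbrev Policy : Type := I.Position → Option (Fin I.numArms)

/-- The initial position. -/
def start : I.Position := fun i => ((I.arm i).root, 0)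

/-- The position after arm `i` was played with outcome `y`. -/
def advance (x : I.Position) (i : Fin I.numArms) (y : ℝ≥0) : I.Position :=
  Function.update x i ((I.arm i).next (x i).1 y, (x i).2 + 1)

/-- The expected reward that policy `π` accrues in at most `t` further plays from position `x`
when the true parameters of the arms are `θ`. -/
noncomputable def rewardFrom (π : I.Policy) (θ : ∀ i, (I.arm i).Θ) : ℕ → I.Position → ℝ≥0∞
  | 0, _ => 0
  | t + 1, x =>
    match π x with
    | none => 0
    | some i => ∫⁻ y, (min (y : ℝ≥0∞) ((I.arm i).remaining (x i).1)
        + rewardFrom π θ t (I.advance x i y)) ∂((I.arm i).law (θ i))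

/-- The expected reward of a policy over the horizon: the parameters of the arms are drawn
independently from the priors. -/
noncomputable def value (π : I.Policy) : ℝ≥0∞ :=
  ∫⁻ θ, I.rewardFrom π θ I.horizon I.start ∂(Measure.pi fun i => (I.arm i).prior)

/-- The optimum of the expected reward over all policies. -/
noncomputable def optimum : ℝ≥0∞ := ⨆ π : I.Policy, I.value π

/-! ### Input and output of algorithms -/

/-- All states of all arms. -/
abbrev State : Type := Σ i, Fin (I.arm i).card

/-- The numbering of all states of all arms by `0, …, totalStates - 1`, arm after arm. -/
def number : I.State ≃ Fin I.totalStates := finSigmaFinEquiv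

/-- The probability that a play in state `a` leads to state `b` (zero for different arms). -/
noncomputable def transition (a b : I.State) : ℝ :=
  ((I.arm a.1).outcome a.2).real {y | (⟨a.1, (I.arm a.1).next a.2 y⟩ : I.State) = b}

/-- The input of the planning algorithm. Natural-number arrays: array `0` holds the horizon, the
number of arms and the total number of states; array `1` the sizes of the state spaces and
array `2` the numbers of the initial states of the arms. Real arrays: array `0` holds the expected
rewards of the states, and array `1`, row by row, the matrix of the transition probabilities. -/
noncomputable def input : Store where
  nat
    | 0, 0 => I.horizon
    | 0, 1 => I.numArms
    | 0, 2 => I.totalStates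
    | 1, i => if h : i < I.numArms then (I.arm ⟨i, h⟩).card else 0
    | 2, i => if h : i < I.numArms then I.number ⟨⟨i, h⟩, (I.arm ⟨i, h⟩).root⟩ else 0
    | _, _ => 0
  real
    | 0, g => if h : g < I.totalStates then
        ((I.arm (I.number.symm ⟨g, h⟩).1).reward (I.number.symm ⟨g, h⟩).2).toReal else 0
    | 1, g => if h : g < I.totalStates * I.totalStates then
        I.transition (I.number.symm (finProdFinEquiv.symm ⟨g, h⟩).1)
          (I.number.symm (finProdFinEquiv.symm ⟨g, h⟩).2) else 0
    | _, _ => 0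

/-- Present a position to an algorithm: the numbers of the current states of the arms are written
into the natural-number array `3`, and the numbers of plays into array `4`. -/
def present (s : Store) (x : I.Position) : Store where
  nat
    | 3, i => if h : i < I.numArms then I.number ⟨⟨i, h⟩, (x ⟨i, h⟩).1⟩ else 0
    | 4, i => if h : i < I.numArms then (x ⟨i, h⟩).2 else 0
    | a, j => s.nat a j
  real := s.real

/-- The code of a decision: `0` for quitting and `i + 1` for a play of arm `i`. -/
def decisionCode : Option (Fin I.numArms) → ℕ
  | none => 0
  | some i => (i : ℕ) + 1

/-- The program `act`, started on the memory `s` with the current position added, computes the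
decisions of the policy `π` within the horizon in at most `b` steps each, and leaves their codes
in cell `0` of the natural-number array `5`. So `s` and `act` describe the policy `π`. -/
def Executes (act : Prog) (s : Store) (b : ℕ) (π : I.Policy) : Prop :=
  ∀ x : I.Position, ∑ i, (x i).2 < I.horizon →
    ∃ (s' : Store) (c : ℕ), act.Runs (I.present s x) s' c ∧ c ≤ b ∧
      s'.nat 5 0 = I.decisionCode (π x)

end Instance

end BayesBandit

/-!
The policy is an index policy over single-arm stopping rules. A *node* of an arm is a state together
with the number of plays so far, and a stopping rule is a set of nodes in which the arm goes on. For
every arm, `R` and `τ` are the expected reward and the expected number of plays of the rule.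

*From Bayesian bandits to Markov chains.* By Bayes' rule, a policy has the same value as in the
Markov decision process on the positions in which every play has the expected reward of the current
state (`Instance.value_eq`). Posteriors average to the prior and budgets only shrink, so the
expected reward of a play does not increase in expectation (`Arm.lintegral_reward_next_le`). Hence
truncating a rule to `t` of `T` plays keeps at least the fraction `t / T` of its reward
(`Chain.mul_total_le_mul_run`).

*Upper bound.* If every play is charged `a ≥ 0`, the arms decouple, and the optimum is at most
`D = a * T + W`, where `W` is the sum of the optimal net rewards of the arms
(`Instance.expectedReward_le`).

*Lower bound.* Run the rules of the arms one after another by decreasing index `R / τ`. Each earlier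
arm `j` uses up the fraction `τ j / T` of the time in expectation, and so costs arm `i` at most this
fraction of `R i`; by the choice of the order, this loss is `min (R i * τ j) (R j * τ i) / T`.
Altogether the policy earns at least `score / (2 * T)` (`Instance.ruleScore_le`), an expression that
can be computed.

*The rules.* Starting from the empty rule, add greedily the node with the largest reward per play.
Stage after stage, the rule is optimal for smaller and smaller charges, and consecutive stages are
optimal for a common charge (`Chain.exists_optimal_stage`). Consider the first stage with at least
`T` expected plays in total and the stage before, with their common charge `a`. They differ at one
node, hence at one arm. A mixture of the two has exactly `T` expected plays, so its reward is `D`,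
and its losses amount to at most `D / 2`. As the score is convex along the mixture, one of the two
stages has a score of at least `T * D` (`mul_le_max_score`). So the stage of largest score is good
enough (`Instance.optimum_div_two_le_value`).

*The algorithm.* There are `T * N` nodes for `N` states, so `Program.plan` simply goes through all
stages, evaluates each by backward induction, and keeps the best (`Program.plan_spec`).
`Program.act` plays the arm of largest index that is not stopped (`Program.act_spec`). The running
times follow from a rule for counting loops (`Prog.achieves_forLoop`, `Prog.loop_cost_le`).
-/

namespace BayesBandit

/-! ### Stopping a Markov chain with rewards -/

/-- A finite Markov chain on the states `0, …, size - 1` with a reward for each step and a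
horizon. States are natural numbers (only those below `size` matter), in the form in which the
algorithm reads them from its input. -/
structure Chain where
  horizon : ℕ
  size : ℕ
  reward : ℕ → ℝ
  trans : ℕ → ℕ → ℝ

namespace Chain

variable (M : Chain)

/-- Rewards and transition probabilities are nonnegative, and the latter sum to one. -/
structure Valid : Prop where
  reward_nonneg : ∀ g < M.size, 0 ≤ M.reward g
  trans_nonneg : ∀ g < M.size, ∀ h < M.size, 0 ≤ M.trans g h
  trans_sum : ∀ g < M.size, ∑ h ∈ Finset.range M.size, M.trans g h = 1

/-- The expectation of `f` after one step from state `g`. -/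
def expect (f : ℕ → ℝ) (g : ℕ) : ℝ := ∑ h ∈ Finset.range M.size, M.trans g h * f h

open Classical in
/-- A set `C` of nodes `(k, g)` (number of earlier steps and state) is a stopping rule: make a
step as long as the current node is in `C`. `M.run C w d k g` is the expected total of the
weights `w` of the states in which a step is made, in at most `d` steps from node `(k, g)`. -/
noncomputable def run (C : ℕ → ℕ → Prop) (w : ℕ → ℝ) : ℕ → ℕ → ℕ → ℝ
  | 0, _, _ => 0
  | d + 1, k, g => if C k g then w g + M.expect (run C w d (k + 1)) g else 0

/-- The expected total weight from node `(k, g)` up to the horizon. -/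
noncomputable def total (C : ℕ → ℕ → Prop) (w : ℕ → ℝ) (k g : ℕ) : ℝ :=
  M.run C w (M.horizon - k) k g

/-- The expected total weight up to the horizon, if a step is made at node `(k, g)` and the rule
`C` is followed from then on. -/
noncomputable def cont (C : ℕ → ℕ → Prop) (w : ℕ → ℝ) (k g : ℕ) : ℝ :=
  w g + M.expect (M.total C w (k + 1)) g

variable {M}

lemma expect_mono (hM : M.Valid) {f f' : ℕ → ℝ} {g : ℕ} (hg : g < M.size)
    (h : ∀ h < M.size, M.trans g h ≠ 0 → f h ≤ f' h) : M.expect f g ≤ M.expect f' g := by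
  refine Finset.sum_le_sum fun j hj => ?_
  rw [Finset.mem_range] at hj
  by_cases h0 : M.trans g j = 0
  · simp [h0]
  · exact mul_le_mul_of_nonneg_left (h j hj h0) (hM.trans_nonneg g hg j hj)

lemma expect_congr {f f' : ℕ → ℝ} {g : ℕ} (h : ∀ h < M.size, f h = f' h) :
    M.expect f g = M.expect f' g :=
  Finset.sum_congr rfl fun j hj => by rw [h j (Finset.mem_range.1 hj)]

lemma expect_const (hM : M.Valid) (c : ℝ) {g : ℕ} (hg : g < M.size) :
    M.expect (fun _ => c) g = c := by
  simp [expect, ← Finset.sum_mul, hM.trans_sum g hg]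

lemma expect_sub (f f' : ℕ → ℝ) (g : ℕ) :
    M.expect (fun h => f h - f' h) g = M.expect f g - M.expect f' g := by
  simp [expect, mul_sub]

lemma expect_const_mul (c : ℝ) (f : ℕ → ℝ) (g : ℕ) :
    M.expect (fun h => c * f h) g = c * M.expect f g := by
  simp only [expect, Finset.mul_sum]
  exact Finset.sum_congr rfl fun _ _ => by ring

lemma expect_nonneg (hM : M.Valid) {f : ℕ → ℝ} {g : ℕ} (hg : g < M.size)
    (h : ∀ h < M.size, 0 ≤ f h) : 0 ≤ M.expect f g :=
  Finset.sum_nonneg fun j hj =>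
    mul_nonneg (hM.trans_nonneg g hg j (Finset.mem_range.1 hj)) (h j (Finset.mem_range.1 hj))

lemma run_of_mem {C : ℕ → ℕ → Prop} {w : ℕ → ℝ} {d k g : ℕ} (h : C k g) :
    M.run C w (d + 1) k g = w g + M.expect (M.run C w d (k + 1)) g := by
  simp [run, h]

lemma run_of_not_mem {C : ℕ → ℕ → Prop} {w : ℕ → ℝ} {d k g : ℕ} (h : ¬ C k g) :
    M.run C w d k g = 0 := by
  cases d <;> simp [run, h]

lemma total_of_mem {C : ℕ → ℕ → Prop} {w : ℕ → ℝ} {k g : ℕ} (hk : k < M.horizon) (h : C k g) :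
    M.total C w k g = M.cont C w k g := by
  obtain ⟨d, hd⟩ : ∃ d, M.horizon - k = d + 1 := ⟨M.horizon - k - 1, by omega⟩
  have : M.horizon - (k + 1) = d := by omega
  rw [total, hd, run_of_mem h, cont]
  congr 2
  funext j
  rw [total, this]

lemma total_of_not_mem {C : ℕ → ℕ → Prop} {w : ℕ → ℝ} {k g : ℕ} (h : ¬ C k g) :
    M.total C w k g = 0 := run_of_not_mem h

lemma total_horizon {C : ℕ → ℕ → Prop} {w : ℕ → ℝ} {k g : ℕ} (h : M.horizon ≤ k) :
    M.total C w k g = 0 := by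
  simp [total, Nat.sub_eq_zero_of_le h, run]

lemma run_nonneg (hM : M.Valid) {C : ℕ → ℕ → Prop} {w : ℕ → ℝ} (hw : ∀ g < M.size, 0 ≤ w g)
    (d k : ℕ) {g : ℕ} (hg : g < M.size) : 0 ≤ M.run C w d k g := by
  induction d generalizing k g with
  | zero => simp [run]
  | succ d ih =>
    by_cases h : C k g
    · rw [run_of_mem h]
      exact add_nonneg (hw g hg) (expect_nonneg hM hg fun j hj => ih (k + 1) hj)
    · rw [run_of_not_mem h]

lemma run_sub (C : ℕ → ℕ → Prop) (w : ℕ → ℝ) (a : ℝ) (d k g : ℕ) :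
    M.run C (fun g => w g - a) d k g = M.run C w d k g - a * M.run C (fun _ => 1) d k g := by
  induction d generalizing k g with
  | zero => simp [run]
  | succ d ih =>
    by_cases h : C k g
    · simp only [run_of_mem h]
      have : M.run C (fun g => w g - a) d (k + 1) =
        fun j => M.run C w d (k + 1) j - a * M.run C (fun _ => 1) d (k + 1) j := funext (ih (k + 1))
      rw [this, expect_sub, expect_const_mul]
      ring
    · simp [run_of_not_mem h]

lemma cont_sub (C : ℕ → ℕ → Prop) (w : ℕ → ℝ) (a : ℝ) (k g : ℕ) :
    M.cont C (fun g => w g - a) k g = M.cont C w k g - a * M.cont C (fun _ => 1) k g := by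
  have : M.total C (fun g => w g - a) (k + 1) =
      fun j => M.total C w (k + 1) j - a * M.total C (fun _ => 1) (k + 1) j :=
    funext fun j => run_sub C w a _ _ _
  simp only [cont]
  rw [this, expect_sub, expect_const_mul]
  ring

lemma one_le_cont (hM : M.Valid) (C : ℕ → ℕ → Prop) (k : ℕ) {g : ℕ} (hg : g < M.size) :
    1 ≤ M.cont C (fun _ => 1) k g :=
  le_add_of_nonneg_right (expect_nonneg hM hg fun _ hj => run_nonneg hM (by simp) _ _ hj)

lemma cont_reward_nonneg (hM : M.Valid) (C : ℕ → ℕ → Prop) (k : ℕ) {g : ℕ} (hg : g < M.size) :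
    0 ≤ M.cont C M.reward k g :=
  add_nonneg (hM.reward_nonneg g hg)
    (expect_nonneg hM hg fun _ hj => run_nonneg hM hM.reward_nonneg _ _ hj)

/-- The outcome of a stopping rule depends on the rule only in the states that can be reached. -/
lemma run_congr_of_closed {Q : ℕ → Prop} (hQ : ∀ g h, Q g → h < M.size → M.trans g h ≠ 0 → Q h)
    {C C' : ℕ → ℕ → Prop} {w : ℕ → ℝ} {d k g : ℕ} (hg : g < M.size) (hq : Q g)
    (h : ∀ k' < k + d, ∀ g' < M.size, Q g' → (C k' g' ↔ C' k' g')) :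
    M.run C w d k g = M.run C' w d k g := by
  induction d generalizing k g with
  | zero => rfl
  | succ d ih =>
    have hc : M.expect (M.run C w d (k + 1)) g = M.expect (M.run C' w d (k + 1)) g := by
      refine Finset.sum_congr rfl fun j hj => ?_
      by_cases h0 : M.trans g j = 0
      · simp [h0]
      · rw [ih (Finset.mem_range.1 hj) (hQ g j hq (Finset.mem_range.1 hj) h0)
          fun k' hk' => h k' (by omega)]
    by_cases hm : C k g
    · rw [run_of_mem hm, run_of_mem ((h k (by omega) g hg hq).1 hm), hc]
    · rw [run_of_not_mem hm, run_of_not_mem (mt (h k (by omega) g hg hq).2 hm)]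

lemma run_congr {C C' : ℕ → ℕ → Prop} {w : ℕ → ℝ} {d k g : ℕ} (hg : g < M.size)
    (h : ∀ k' < k + d, ∀ g' < M.size, (C k' g' ↔ C' k' g')) :
    M.run C w d k g = M.run C' w d k g :=
  run_congr_of_closed (Q := fun _ => True) (fun _ _ _ _ _ => trivial) hg trivial
    fun k' hk' g' hg' _ => h k' hk' g' hg'

lemma run_one_of_forall_mem (hM : M.Valid) {C : ℕ → ℕ → Prop} {d k g : ℕ} (hg : g < M.size)
    (h : ∀ k' < k + d, ∀ g' < M.size, C k' g') : M.run C (fun _ => 1) d k g = d := by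
  induction d generalizing k g with
  | zero => simp [run]
  | succ d ih =>
    rw [run_of_mem (h k (by omega) g hg),
      expect_congr fun j hj => ih hj fun k' hk' => h k' (by omega), expect_const hM _ hg]
    push_cast
    ring

/-! ### Truncation of a stopping rule -/

/-- A family of nodes that is closed under transitions of positive probability, and on which the
reward of a step does not increase in expectation. -/
structure Decreasing (M : Chain) (Q : ℕ → ℕ → Prop) : Prop where
  step : ∀ k < M.horizon, ∀ g < M.size, Q k g → ∀ h < M.size, M.trans g h ≠ 0 → Q (k + 1) h
  reward : ∀ k, k + 1 < M.horizon → ∀ g < M.size, Q k g → M.expect M.reward g ≤ M.reward g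

lemma run_succ_sub_antitone (hM : M.Valid) {Q : ℕ → ℕ → Prop} (hQ : M.Decreasing Q)
    {C : ℕ → ℕ → Prop} {d k g : ℕ} (hd : k + d + 1 < M.horizon) (hg : g < M.size) (hq : Q k g) :
    M.run C M.reward (d + 2) k g - M.run C M.reward (d + 1) k g ≤
      M.run C M.reward (d + 1) k g - M.run C M.reward d k g := by
  induction d generalizing k g with
  | zero =>
    by_cases h : C k g
    · rw [run_of_mem h, run_of_mem h]
      have h1 : M.expect (M.run C M.reward 1 (k + 1)) g ≤ M.expect M.reward g := by
        refine expect_mono hM hg fun j hj _ => ?_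
        by_cases h' : C (k + 1) j
        · simp [run, h', expect]
        · rw [run_of_not_mem h']; exact hM.reward_nonneg j hj
      have h2 := hQ.reward k (by omega) g hg hq
      have h3 : M.expect (M.run C M.reward 0 (k + 1)) g = 0 := by simp [run, expect]
      have h4 : M.run C M.reward 0 k g = 0 := rfl
      linarith
    · simp [run_of_not_mem h]
  | succ d ih =>
    by_cases h : C k g
    · rw [run_of_mem h, run_of_mem h, run_of_mem h]
      have h1 : M.expect (fun j => M.run C M.reward (d + 2) (k + 1) j
            - M.run C M.reward (d + 1) (k + 1) j) g ≤
          M.expect (fun j => M.run C M.reward (d + 1) (k + 1) j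
            - M.run C M.reward d (k + 1) j) g :=
        expect_mono hM hg fun j hj h0 =>
          ih (by omega) hj (hQ.step k (by omega) g hg hq j hj h0)
      rw [expect_sub, expect_sub] at h1
      linarith
    · simp [run_of_not_mem h]

lemma mul_le_mul_of_sub_antitone {f : ℕ → ℝ} (h0 : f 0 = 0) {m : ℕ}
    (h : ∀ d, d + 1 < m → f (d + 2) - f (d + 1) ≤ f (d + 1) - f d) {t : ℕ} (ht : t ≤ m) :
    t * f m ≤ m * f t := by
  have hanti : ∀ a b, a ≤ b → b < m → f (b + 1) - f b ≤ f (a + 1) - f a := by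
    intro a b hab
    induction b, hab using Nat.le_induction with
    | base => exact fun _ => le_rfl
    | succ b _ ih => exact fun hb => (h b hb).trans (ih (by omega))
  have hinc : ∀ b < m, ∀ s ≤ b, s * (f (b + 1) - f b) ≤ f s := by
    intro b hb s hs
    induction s with
    | zero => simp [h0]
    | succ s ih =>
      have h1 := ih (by omega)
      have h2 := hanti s b (by omega) hb
      push_cast
      linarith
  have key : ∀ b, t ≤ b → b ≤ m → t * f b ≤ b * f t := by
    intro b hb
    induction b, hb using Nat.le_induction with
    | base => exact fun _ => le_rfl
    | succ b hb ih =>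
      intro hbm
      have h1 := ih (by omega)
      have h2 := hinc b (by omega) t hb
      push_cast
      linarith
  exact key m ht le_rfl

/-- Truncating a stopping rule to `t` of `T` steps keeps at least the fraction `t / T` of its
reward, since the expected reward of the `j`-th step does not increase with `j`. -/
lemma mul_total_le_mul_run (hM : M.Valid) {Q : ℕ → ℕ → Prop} (hQ : M.Decreasing Q)
    {C : ℕ → ℕ → Prop} {t g : ℕ} (ht : t ≤ M.horizon) (hg : g < M.size) (hq : Q 0 g) :
    t * M.total C M.reward 0 g ≤ M.horizon * M.run C M.reward t 0 g :=
  mul_le_mul_of_sub_antitone (f := fun d => M.run C M.reward d 0 g) rfl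
    (fun _ hd => run_succ_sub_antitone hM hQ (by omega) hg hq) ht

/-! ### Stopping rules that are optimal for a charge per step -/

/-- The stopping rule `C` is optimal, from every node, if each step is charged `a`. -/
def Optimal (M : Chain) (C : ℕ → ℕ → Prop) (a : ℝ) : Prop :=
  ∀ k < M.horizon, ∀ g < M.size,
    (C k g → 0 ≤ M.cont C (fun g => M.reward g - a) k g) ∧
    (¬ C k g → M.cont C (fun g => M.reward g - a) k g ≤ 0)

lemma Optimal.cont_le_total {C : ℕ → ℕ → Prop} {a : ℝ} (h : M.Optimal C a) {k g : ℕ}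
    (hk : k < M.horizon) (hg : g < M.size) :
    M.cont C (fun g => M.reward g - a) k g ≤ M.total C (fun g => M.reward g - a) k g := by
  by_cases hC : C k g
  · rw [total_of_mem hk hC]
  · rw [total_of_not_mem hC]; exact (h k hk g hg).2 hC

lemma Optimal.total_nonneg {C : ℕ → ℕ → Prop} {a : ℝ} (h : M.Optimal C a) {k g : ℕ}
    (hg : g < M.size) : 0 ≤ M.total C (fun g => M.reward g - a) k g := by
  by_cases hC : C k g
  · by_cases hk : k < M.horizon
    · rw [total_of_mem hk hC]; exact (h k hk g hg).1 hC
    · rw [total_horizon (by omega)]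
  · rw [total_of_not_mem hC]

/-- The totals of two rules that are optimal for the same charge agree. -/
lemma Optimal.total_eq {C C' : ℕ → ℕ → Prop} {a : ℝ} (h : M.Optimal C a) (h' : M.Optimal C' a)
    (k : ℕ) {g : ℕ} (hg : g < M.size) :
    M.total C' (fun g => M.reward g - a) k g = M.total C (fun g => M.reward g - a) k g := by
  obtain ⟨d, hd⟩ : ∃ d, M.horizon - k = d := ⟨_, rfl⟩
  induction d generalizing k g with
  | zero => rw [total_horizon (by omega), total_horizon (by omega)]
  | succ d ih =>
    have hk : k < M.horizon := by omega
    have hcont : M.cont C' (fun g => M.reward g - a) k g =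
        M.cont C (fun g => M.reward g - a) k g := by
      rw [cont, cont, expect_congr fun j hj => ih (k + 1) hj (by omega)]
    have h1 := h k hk g hg
    have h2 := h' k hk g hg
    rw [hcont] at h2
    by_cases hC : C k g <;> by_cases hC' : C' k g
    · rw [total_of_mem hk hC, total_of_mem hk hC', hcont]
    · rw [total_of_mem hk hC, total_of_not_mem hC']
      exact le_antisymm (h1.1 hC) (h2.2 hC')
    · rw [total_of_mem hk hC', total_of_not_mem hC, hcont]
      exact le_antisymm (h1.2 hC) (h2.1 hC')
    · rw [total_of_not_mem hC, total_of_not_mem hC']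

/-- The reward per step at node `(k, g)`, if a step is made there and the rule `C` is followed
from then on. -/
noncomputable def ratio (M : Chain) (C : ℕ → ℕ → Prop) (k g : ℕ) : ℝ :=
  M.cont C M.reward k g / M.cont C (fun _ => 1) k g

lemma ratio_nonneg (hM : M.Valid) (C : ℕ → ℕ → Prop) (k : ℕ) {g : ℕ} (hg : g < M.size) :
    0 ≤ M.ratio C k g :=
  div_nonneg (cont_reward_nonneg hM C k hg) (zero_le_one.trans (one_le_cont hM C k hg))

lemma cont_sub_le_zero_iff (hM : M.Valid) (C : ℕ → ℕ → Prop) (k : ℕ) {g : ℕ} (hg : g < M.size)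
    (a : ℝ) : M.cont C (fun g => M.reward g - a) k g ≤ 0 ↔ M.ratio C k g ≤ a := by
  rw [cont_sub, sub_nonpos, ratio, div_le_iff₀ (zero_lt_one.trans_le (one_le_cont hM C k hg))]

lemma Optimal.mono (hM : M.Valid) {C : ℕ → ℕ → Prop} {a b : ℝ} (h : M.Optimal C a) (hab : b ≤ a)
    (hb : ∀ k < M.horizon, ∀ g < M.size, ¬ C k g → M.ratio C k g ≤ b) : M.Optimal C b := by
  refine fun k hk g hg => ⟨fun hC => ?_, fun hC => (cont_sub_le_zero_iff hM C k hg b).2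
    (hb k hk g hg hC)⟩
  have h1 := (h k hk g hg).1 hC
  rw [cont_sub] at h1 ⊢
  nlinarith [one_le_cont hM C k hg]

/-- Adding a node at which going on and stopping are equally good does not change the totals. -/
lemma total_insert {C C' : ℕ → ℕ → Prop} {w : ℕ → ℝ} {k₀ g₀ : ℕ}
    (hC' : ∀ k < M.horizon, ∀ g < M.size, (C' k g ↔ C k g ∨ (k = k₀ ∧ g = g₀)))
    (h₀ : M.cont C w k₀ g₀ = 0) (k : ℕ) {g : ℕ} (hg : g < M.size) :
    M.total C' w k g = M.total C w k g := by
  obtain ⟨d, hd⟩ : ∃ d, M.horizon - k = d := ⟨_, rfl⟩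
  induction d generalizing k g with
  | zero => rw [total_horizon (by omega), total_horizon (by omega)]
  | succ d ih =>
    have hk : k < M.horizon := by omega
    have hcont : M.cont C' w k g = M.cont C w k g := by
      rw [cont, cont, expect_congr fun j hj => ih (k + 1) hj (by omega)]
    by_cases h : C k g
    · rw [total_of_mem hk h, total_of_mem hk ((hC' k hk g hg).2 (.inl h)), hcont]
    · by_cases h' : k = k₀ ∧ g = g₀
      · rw [total_of_mem hk ((hC' k hk g hg).2 (.inr h')), total_of_not_mem h, hcont, h'.1, h'.2,
          h₀]
      · rw [total_of_not_mem h, total_of_not_mem (by rw [hC' k hk g hg]; tauto)]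

lemma Optimal.insert {C C' : ℕ → ℕ → Prop} {a : ℝ} {k₀ g₀ : ℕ} (h : M.Optimal C a)
    (hC' : ∀ k < M.horizon, ∀ g < M.size, (C' k g ↔ C k g ∨ (k = k₀ ∧ g = g₀)))
    (h₀ : M.cont C (fun g => M.reward g - a) k₀ g₀ = 0) : M.Optimal C' a := by
  intro k hk g hg
  have hcont : M.cont C' (fun g => M.reward g - a) k g =
      M.cont C (fun g => M.reward g - a) k g := by
    rw [cont, cont, expect_congr fun j hj => total_insert hC' h₀ (k + 1) hj]
  rw [hcont, hC' k hk g hg]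
  refine ⟨?_, fun hC => (h k hk g hg).2 fun h' => hC (.inl h')⟩
  rintro (hC | ⟨rfl, rfl⟩)
  · exact (h k hk g hg).1 hC
  · exact h₀.ge

lemma exists_optimal_of_empty (hM : M.Valid) {C : ℕ → ℕ → Prop}
    (hC : ∀ k < M.horizon, ∀ g < M.size, ¬ C k g) : ∃ a, 0 ≤ a ∧ M.Optimal C a := by
  refine ⟨∑ g ∈ Finset.range M.size, M.reward g,
    Finset.sum_nonneg fun g hg => hM.reward_nonneg g (Finset.mem_range.1 hg),
    fun k hk g hg => ⟨fun h => absurd h (hC k hk g hg), fun _ => ?_⟩⟩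
  have h0 : M.expect (M.total C (fun g => M.reward g - ∑ g ∈ Finset.range M.size, M.reward g)
      (k + 1)) g = 0 := by
    refine Finset.sum_eq_zero fun j hj => ?_
    rw [Finset.mem_range] at hj
    by_cases hk' : k + 1 < M.horizon
    · rw [total_of_not_mem (hC _ hk' _ hj), mul_zero]
    · rw [total_horizon (by omega), mul_zero]
  rw [cont, h0, add_zero, sub_nonpos]
  exact Finset.single_le_sum (f := M.reward)
    (fun g hg => hM.reward_nonneg g (Finset.mem_range.1 hg)) (Finset.mem_range.2 hg)

/-! ### The greedy sequence of stopping rules -/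

/-- `o` records the order in which nodes enter a growing stopping rule: the node `(k, g)`, with
address `k * size + g`, enters as number `o (k * size + g)` (from `1`; `0` means never).
`M.stage o c` is the set of the first `c` nodes. -/
def stage (M : Chain) (o : ℕ → ℕ) (c k g : ℕ) : Prop :=
  1 ≤ o (k * M.size + g) ∧ o (k * M.size + g) ≤ c

/-- The step from stage `c` to stage `c + 1` is greedy: unless all nodes have been taken, a node
of the largest ratio among the remaining ones is added. -/
def GreedyStep (M : Chain) (o : ℕ → ℕ) (c : ℕ) : Prop :=
  (∀ k < M.horizon, ∀ g < M.size, M.stage o c k g) ∨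
  ∃ k₀ < M.horizon, ∃ g₀ < M.size, ¬ M.stage o c k₀ g₀ ∧
    (∀ k < M.horizon, ∀ g < M.size,
      (M.stage o (c + 1) k g ↔ M.stage o c k g ∨ (k = k₀ ∧ g = g₀))) ∧
    ∀ k < M.horizon, ∀ g < M.size, ¬ M.stage o c k g →
      M.ratio (M.stage o c) k g ≤ M.ratio (M.stage o c) k₀ g₀

/-- While nodes remain, consecutive greedy stages are both optimal for a common charge: the
charge at which going on becomes as good as stopping at the best remaining node. Lowering the
charge to this value keeps the earlier nodes worthwhile. -/
lemma exists_optimal_stage (hM : M.Valid) {o : ℕ → ℕ} {c : ℕ}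
    (h : ∀ c' < c, M.GreedyStep o c') :
    ∃ a, 0 ≤ a ∧ M.Optimal (M.stage o c) a ∧
      ∀ c', c = c' + 1 → ¬ (∀ k < M.horizon, ∀ g < M.size, M.stage o c' k g) →
        M.Optimal (M.stage o c') a := by
  induction c with
  | zero =>
    obtain ⟨a, ha, hopt⟩ := exists_optimal_of_empty hM (C := M.stage o 0)
      fun k _ g _ => by simp only [stage]; omega
    exact ⟨a, ha, hopt, by omega⟩
  | succ c ih =>
    obtain ⟨a, ha, hopt, -⟩ := ih fun c' hc' => h c' (by omega)
    rcases h c (by omega) with hfull | ⟨k₀, hk₀, g₀, hg₀, hn, hins, hmax⟩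
    · refine ⟨a, ha, fun k hk g hg => ?_, fun c' hc' hnot => ?_⟩
      · have hfull' : ∀ k < M.horizon, ∀ g < M.size,
            (M.stage o c k g ↔ M.stage o (c + 1) k g) := fun k hk g hg =>
          iff_of_true (hfull k hk g hg) ⟨(hfull k hk g hg).1, (hfull k hk g hg).2.trans c.le_succ⟩
        have hcont : ∀ w, M.cont (M.stage o (c + 1)) w k g = M.cont (M.stage o c) w k g := by
          intro w
          rw [cont, cont]
          congr 1
          refine expect_congr fun j hj => (run_congr hj fun k' hk' g' hg' => ?_).symm
          exact hfull' k' (by omega) g' hg'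
        rw [hcont, ← hfull' k hk g hg]
        exact hopt k hk g hg
      · obtain rfl : c = c' := by omega
        exact absurd hfull hnot
    · have hle : M.ratio (M.stage o c) k₀ g₀ ≤ a :=
        (cont_sub_le_zero_iff hM _ _ hg₀ a).1 ((hopt k₀ hk₀ g₀ hg₀).2 hn)
      have hopt' := hopt.mono hM hle hmax
      refine ⟨_, ratio_nonneg hM _ _ hg₀, hopt'.insert hins ?_, fun c' hc' _ => ?_⟩
      · rw [cont_sub, ratio, div_mul_cancel₀, sub_self]
        exact (zero_lt_one.trans_le (one_le_cont hM _ _ hg₀)).ne'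
      · obtain rfl : c = c' := by omega
        exact hopt'

/-- After as many greedy steps as there are nodes, all nodes have been taken. -/
lemma stage_full {o : ℕ → ℕ} (h : ∀ c, c < M.horizon * M.size → M.GreedyStep o c) :
    ∀ k < M.horizon, ∀ g < M.size, M.stage o (M.horizon * M.size) k g := by
  classical
  let F : ℕ → Finset (ℕ × ℕ) := fun c =>
    (Finset.range M.horizon ×ˢ Finset.range M.size).filter fun x => M.stage o c x.1 x.2
  have key : ∀ c ≤ M.horizon * M.size,
      (∀ k < M.horizon, ∀ g < M.size, M.stage o c k g) ∨ c ≤ (F c).card := by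
    intro c
    induction c with
    | zero => exact fun _ => .inr (Nat.zero_le _)
    | succ c ih =>
      intro hc
      have hmono : ∀ k g, M.stage o c k g → M.stage o (c + 1) k g :=
        fun k g hs => ⟨hs.1, hs.2.trans c.le_succ⟩
      rcases ih (by omega) with hfull | hcard
      · exact .inl fun k hk g hg => hmono k g (hfull k hk g hg)
      rcases h c (by omega) with hfull | ⟨k₀, hk₀, g₀, hg₀, hn, hins, -⟩
      · exact .inl fun k hk g hg => hmono k g (hfull k hk g hg)
      refine .inr ?_
      have hlt : F c ⊂ F (c + 1) := by
        refine Finset.ssubset_iff_of_subset (fun x hx => ?_) |>.2 ⟨(k₀, g₀), ?_, ?_⟩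
        · simp only [F, Finset.mem_filter] at hx ⊢
          exact ⟨hx.1, hmono _ _ hx.2⟩
        · simp [F, hk₀, hg₀, hins k₀ hk₀ g₀ hg₀]
        · simp [F, hn]
      have := Finset.card_lt_card hlt
      omega
  rcases key _ le_rfl with hfull | hcard
  · exact hfull
  intro k hk g hg
  have hall : F (M.horizon * M.size) = Finset.range M.horizon ×ˢ Finset.range M.size := by
    refine Finset.eq_of_subset_of_card_le (Finset.filter_subset _ _) ?_
    simpa using hcard
  have : (k, g) ∈ F (M.horizon * M.size) := by rw [hall]; simp [hk, hg]
  exact (Finset.mem_filter.1 this).2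

end Chain

/-! ### The score of a family of stopping rules -/

/-- Let `R i` and `τ i` be the expected reward and number of steps of a stopping rule for arm `i`.
`score n T R τ` is `2 * T` times a lower bound on the expected reward of running the rules of `n`
arms one after another, by decreasing `R i / τ i`, for a total of `T` steps: arm `i` loses at most
the fraction `τ j / T` of `R i` for each earlier arm `j`, and the smaller of `R i * τ j` and
`R j * τ i` belongs to the later arm. -/
noncomputable def score (n : ℕ) (T : ℝ) (R τ : ℕ → ℝ) : ℝ :=
  ∑ i ∈ Finset.range n,
    ((2 * T + τ i) * R i - ∑ j ∈ Finset.range n, min (R i * τ j) (R j * τ i))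

/-- The loss that the arms `i` and `j` inflict on each other, times the horizon. -/
noncomputable def loss (R τ : ℕ → ℝ) (i j : ℕ) : ℝ :=
  if i = j then 0 else min (R i * τ j) (R j * τ i)

lemma score_eq (n : ℕ) (T : ℝ) (R τ : ℕ → ℝ) :
    score n T R τ = 2 * T * ∑ i ∈ Finset.range n, R i -
      ∑ i ∈ Finset.range n, ∑ j ∈ Finset.range n, loss R τ i j := by
  rw [score, Finset.mul_sum, ← Finset.sum_sub_distrib]
  refine Finset.sum_congr rfl fun i hi => ?_
  have h : ∀ j ∈ Finset.range n, loss R τ i j =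
      min (R i * τ j) (R j * τ i) - if i = j then R i * τ i else 0 := by
    intro j _
    by_cases hij : i = j
    · subst hij; simp [loss]
    · simp [loss, hij]
  rw [Finset.sum_congr rfl h, Finset.sum_sub_distrib, Finset.sum_ite_eq, if_pos hi]
  ring

lemma mul_le_score {n : ℕ} {T : ℝ} {R τ : ℕ → ℝ} (hR : ∀ i < n, 0 ≤ R i) (hτ : ∀ i < n, 0 ≤ τ i)
    (hT : ∑ i ∈ Finset.range n, τ i = T) : T * ∑ i ∈ Finset.range n, R i ≤ score n T R τ := by
  have h : ∑ i ∈ Finset.range n, ∑ j ∈ Finset.range n, loss R τ i j ≤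
      ∑ i ∈ Finset.range n, ∑ j ∈ Finset.range n, (R i * τ j + τ i * R j) / 2 := by
    refine Finset.sum_le_sum fun i hi => Finset.sum_le_sum fun j hj => ?_
    rw [Finset.mem_range] at hi hj
    have h1 := mul_nonneg (hR i hi) (hτ j hj)
    have h2 := mul_nonneg (hR j hj) (hτ i hi)
    rw [loss]
    split_ifs
    · linarith
    · linarith [min_le_left (R i * τ j) (R j * τ i), min_le_right (R i * τ j) (R j * τ i)]
  have h' : ∑ i ∈ Finset.range n, ∑ j ∈ Finset.range n, (R i * τ j + τ i * R j) / 2 =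
      T * ∑ i ∈ Finset.range n, R i := by
    simp only [← Finset.sum_div, Finset.sum_add_distrib, ← Finset.mul_sum, ← Finset.sum_mul, hT]
    ring
  rw [score_eq]
  linarith

/-- If two families differ at one arm only, then the score is convex along the segment between
them: the losses are minima of products in which at most one factor varies. -/
lemma score_mix_le {n : ℕ} {T p : ℝ} {R τ R' τ' : ℕ → ℝ} {m : ℕ} (hp : 0 ≤ p)
    (hp' : p ≤ 1) (hR : ∀ i < n, i ≠ m → R' i = R i) (hτ : ∀ i < n, i ≠ m → τ' i = τ i) :
    score n T (fun i => (1 - p) * R i + p * R' i) (fun i => (1 - p) * τ i + p * τ' i) ≤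
      (1 - p) * score n T R τ + p * score n T R' τ' := by
  have h : ∑ i ∈ Finset.range n, ∑ j ∈ Finset.range n,
        ((1 - p) * loss R τ i j + p * loss R' τ' i j) ≤
      ∑ i ∈ Finset.range n, ∑ j ∈ Finset.range n,
        loss (fun i => (1 - p) * R i + p * R' i) (fun i => (1 - p) * τ i + p * τ' i) i j := by
    refine Finset.sum_le_sum fun i hi => Finset.sum_le_sum fun j hj => ?_
    rw [Finset.mem_range] at hi hj
    by_cases hij : i = j
    · simp [loss, hij]
    simp only [loss, if_neg hij]
    have q := sub_nonneg.2 hp'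
    have l1 := mul_le_mul_of_nonneg_left (min_le_left (R i * τ j) (R j * τ i)) q
    have l2 := mul_le_mul_of_nonneg_left (min_le_left (R' i * τ' j) (R' j * τ' i)) hp
    have r1 := mul_le_mul_of_nonneg_left (min_le_right (R i * τ j) (R j * τ i)) q
    have r2 := mul_le_mul_of_nonneg_left (min_le_right (R' i * τ' j) (R' j * τ' i)) hp
    by_cases hi' : i = m
    · have hj' : j ≠ m := fun h => hij (hi'.trans h.symm)
      rw [hR j hj hj', hτ j hj hj'] at *
      exact le_min (by linarith) (by linarith)
    · rw [hR i hi hi', hτ i hi hi'] at *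
      exact le_min (by linarith) (by linarith)
  simp only [Finset.sum_add_distrib, ← Finset.mul_sum] at h
  simp only [score_eq, Finset.sum_add_distrib, ← Finset.mul_sum]
  linarith

/-- Two families that differ at one arm only, both optimal for the charge `a` per step, one with
at most and one with at least `T` expected steps: the better one has a score of at least `T`
times the dual bound `a * T + W`. -/
lemma mul_le_max_score {n : ℕ} {T a W : ℝ} {R τ R' τ' : ℕ → ℝ} {m : ℕ}
    (hR : ∀ i < n, i ≠ m → R' i = R i) (hτ : ∀ i < n, i ≠ m → τ' i = τ i)
    (hR0 : ∀ i < n, 0 ≤ R i) (hτ0 : ∀ i < n, 0 ≤ τ i)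
    (hR0' : ∀ i < n, 0 ≤ R' i) (hτ0' : ∀ i < n, 0 ≤ τ' i)
    (hW : ∑ i ∈ Finset.range n, R i - a * ∑ i ∈ Finset.range n, τ i = W)
    (hW' : ∑ i ∈ Finset.range n, R' i - a * ∑ i ∈ Finset.range n, τ' i = W)
    (hlt : ∑ i ∈ Finset.range n, τ i < T) (hle : T ≤ ∑ i ∈ Finset.range n, τ' i) :
    T * (a * T + W) ≤ max (score n T R τ) (score n T R' τ') := by
  set S := ∑ i ∈ Finset.range n, τ i
  set S' := ∑ i ∈ Finset.range n, τ' i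
  have hpos : 0 < S' - S := by linarith
  obtain ⟨p, hp⟩ : ∃ p, p = (T - S) / (S' - S) := ⟨_, rfl⟩
  have hp0 : 0 ≤ p := hp ▸ div_nonneg (by linarith) hpos.le
  have hp1 : p ≤ 1 := hp ▸ (div_le_one hpos).2 (by linarith)
  have hpS : p * (S' - S) = T - S := by rw [hp]; exact div_mul_cancel₀ _ hpos.ne'
  have h1p : 0 ≤ 1 - p := sub_nonneg.2 hp1
  have hmix := score_mix_le (T := T) hp0 hp1 hR hτ
  have hmul := mul_le_score (n := n) (T := T)
    (R := fun i => (1 - p) * R i + p * R' i) (τ := fun i => (1 - p) * τ i + p * τ' i)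
    (fun i hi => add_nonneg (mul_nonneg h1p (hR0 i hi)) (mul_nonneg hp0 (hR0' i hi)))
    (fun i hi => add_nonneg (mul_nonneg h1p (hτ0 i hi)) (mul_nonneg hp0 (hτ0' i hi)))
    (by
      simp only [Finset.sum_add_distrib, ← Finset.mul_sum]
      change (1 - p) * S + p * S' = T
      linarith)
  have hsum : ∑ i ∈ Finset.range n, ((1 - p) * R i + p * R' i) = a * T + W := by
    simp only [Finset.sum_add_distrib, ← Finset.mul_sum]
    rw [sub_eq_iff_eq_add.1 hW, sub_eq_iff_eq_add.1 hW']
    linear_combination a * hpS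
  rw [hsum] at hmul
  have m1 := mul_le_mul_of_nonneg_left (le_max_left (score n T R τ) (score n T R' τ')) h1p
  have m2 := mul_le_mul_of_nonneg_left (le_max_right (score n T R τ) (score n T R' τ')) hp0
  linarith

/-! ### Bayesian updating -/

lemma measurable_update_prod {ι : Type*} [DecidableEq ι] {α : ι → Type*}
    [∀ i, MeasurableSpace (α i)] (i : ι) :
    Measurable fun p : α i × (∀ i, α i) => Function.update p.2 i p.1 := by
  refine measurable_pi_lambda _ fun j => ?_
  by_cases hj : j = i
  · subst hj; simpa using measurable_fst
  · simp only [Function.update_of_ne hj]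
    exact (measurable_pi_apply j).comp measurable_snd

/-- Replacing one coordinate of a product measure: resample that coordinate. -/
lemma lintegral_pi_eq_resample {ι : Type*} [Fintype ι] [DecidableEq ι] {α : ι → Type*}
    [∀ i, MeasurableSpace (α i)] (μ μ' : ∀ i, Measure (α i)) [∀ i, IsProbabilityMeasure (μ i)]
    [∀ i, IsProbabilityMeasure (μ' i)] (i : ι) (h : ∀ j, j ≠ i → μ' j = μ j)
    {F : (∀ i, α i) → ℝ≥0∞} (hF : Measurable F) :
    ∫⁻ θ, F θ ∂(Measure.pi μ') =
      ∫⁻ s, ∫⁻ θ, F (Function.update θ i s) ∂(Measure.pi μ) ∂(μ' i) := by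
  have hmeas := measurable_update_prod (α := α) i
  have key : Measure.pi μ' =
      ((μ' i).prod (Measure.pi μ)).map fun p => Function.update p.2 i p.1 := by
    refine Measure.pi_eq fun s hs => ?_
    rw [Measure.map_apply hmeas (MeasurableSet.univ_pi hs)]
    have hpre : (fun p : α i × (∀ i, α i) => Function.update p.2 i p.1) ⁻¹' (Set.univ.pi s) =
        s i ×ˢ (Set.univ.pi (Function.update s i Set.univ)) := by
      ext p
      simp only [Set.mem_preimage, Set.mem_univ_pi, Set.mem_prod]
      constructor
      · refine fun hp => ⟨by simpa using hp i, fun j => ?_⟩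
        by_cases hj : j = i
        · subst hj; simp
        · simpa [Function.update_of_ne hj] using hp j
      · rintro ⟨h1, h2⟩ j
        by_cases hj : j = i
        · subst hj; simpa using h1
        · simpa [Function.update_of_ne hj] using h2 j
    rw [hpre, Measure.prod_prod, Measure.pi_pi, ← Finset.mul_prod_erase _ _ (Finset.mem_univ i),
      ← Finset.mul_prod_erase _ (fun j => μ' j (s j)) (Finset.mem_univ i)]
    simp only [Function.update_self, measure_univ, one_mul]
    congr 1
    refine Finset.prod_congr rfl fun j hj => ?_
    rw [Function.update_of_ne (Finset.ne_of_mem_erase hj), h j (Finset.ne_of_mem_erase hj)]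
  rw [key, lintegral_map hF hmeas, lintegral_prod]
  exact (hF.comp hmeas).aemeasurable

/-- Drawing a parameter and then an observation is the same as drawing the observation from its
marginal and then the parameter from the posterior. -/
lemma lintegral_lintegral_posterior {α β : Type*} [MeasurableSpace α] [MeasurableSpace β]
    [StandardBorelSpace α] [Nonempty α] (κ : Kernel α β) [IsMarkovKernel κ] (μ : Measure α)
    [IsProbabilityMeasure μ] {H : α × β → ℝ≥0∞} (hH : Measurable H) :
    ∫⁻ s, ∫⁻ y, H (s, y) ∂(κ s) ∂μ = ∫⁻ y, ∫⁻ s, H (s, y) ∂((κ†μ) y) ∂(κ ∘ₘ μ) := by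
  rw [← Measure.lintegral_compProd hH,
    ← Measure.lintegral_compProd (f := fun p : β × α => H (p.2, p.1)) (hH.comp measurable_swap),
    compProd_posterior_eq_map_swap,
    lintegral_map (f := fun p : β × α => H (p.2, p.1)) (hH.comp measurable_swap) measurable_swap]
  rfl

namespace Arm

variable {A : Arm.{u}}

instance (v : Fin A.card) : IsProbabilityMeasure (A.outcome v) := by
  unfold outcome; infer_instance

lemma lintegral_next (v : Fin A.card) (f : Fin A.card → ℝ≥0∞) :
    ∫⁻ y, f (A.next v y) ∂(A.outcome v) = ∑ w, f w * A.outcome v {y | A.next v y = w} := by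
  rw [← lintegral_map (f := f) (measurable_of_finite f) (A.measurable_next v), lintegral_fintype]
  refine Finset.sum_congr rfl fun w _ => ?_
  rw [Measure.map_apply (A.measurable_next v) (measurableSet_singleton w)]
  rfl

lemma ae_reach {k : ℕ} {v : Fin A.card} (h : A.Reach k v) :
    ∀ᵐ y ∂(A.outcome v), A.Reach (k + 1) (A.next v y) := by
  have : ∀ w, ∀ᵐ y ∂(A.outcome v), A.next v y = w → A.Reach (k + 1) w := by
    intro w
    by_cases h0 : A.outcome v {y | A.next v y = w} = 0
    · have : ∀ᵐ y ∂(A.outcome v), ¬ A.next v y = w := by rw [ae_iff]; simpa using h0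
      filter_upwards [this] with y hy h' using absurd h' hy
    · exact .of_forall fun y _ => ⟨v, h, h0⟩
  filter_upwards [ae_all_iff.2 this] with y hy using hy _ rfl

/-- The expected reward of a play does not increase in expectation: the posteriors average to the
prior, and the remaining budget only shrinks. -/
lemma lintegral_reward_next_le {T k : ℕ} (hA : A.IsPosteriorSpace T) (hk : k < T)
    {v : Fin A.card} (hv : A.Reach k v) :
    ∫⁻ y, A.reward (A.next v y) ∂(A.outcome v) ≤ A.reward v := by
  have hmeas : Measurable fun z : ℝ≥0 => min (z : ℝ≥0∞) (A.remaining v) :=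
    measurable_coe_nnreal_ennreal.min measurable_const
  calc ∫⁻ y, A.reward (A.next v y) ∂(A.outcome v)
      ≤ ∫⁻ y, ∫⁻ z, min (z : ℝ≥0∞) (A.remaining v)
          ∂((A.law ∘ₖ A.law†(A.post v : Measure A.Θ)) y) ∂(A.outcome v) := by
        refine lintegral_mono_ae ?_
        filter_upwards [hA.bayes k hk v hv, hA.budget k hk v hv] with y h1 h2
        rw [reward, outcome, h1, h2, Kernel.comp_apply]
        exact lintegral_mono fun z => min_le_min le_rfl tsub_le_self
    _ = A.reward v := by
        rw [← Measure.lintegral_bind (Kernel.aemeasurable _) hmeas.aemeasurable, reward]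
        congr 1
        rw [← Measure.comp_assoc, outcome, posterior_comp_self]

end Arm

namespace Instance

variable (I : Instance.{u})

/-- The expected reward of a play of arm `i` in state `v`, as a real number. -/
noncomputable def playReward (i : Fin I.numArms) (v : Fin (I.arm i).card) : ℝ :=
  ((I.arm i).reward v).toReal

/-- The expectation of `f` over the next state after a play of arm `i` in state `v`. -/
noncomputable def playExpect (i : Fin I.numArms) (v : Fin (I.arm i).card)
    (f : Fin (I.arm i).card → ℝ) : ℝ :=
  ∑ w, ((I.arm i).outcome v).real {y | (I.arm i).next v y = w} * f w

/-- The expected reward of policy `π` in at most `t` plays from position `x`, if the parameters of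
the arms are drawn from the posteriors of their states. -/
noncomputable def expectedReward (π : I.Policy) : ℕ → I.Position → ℝ
  | 0, _ => 0
  | t + 1, x =>
    match π x with
    | none => 0
    | some i => I.playReward i (x i).1 + I.playExpect i (x i).1 fun w =>
        expectedReward π t (Function.update x i (w, (x i).2 + 1))

variable {I}

lemma playReward_nonneg (i : Fin I.numArms) (v : Fin (I.arm i).card) : 0 ≤ I.playReward i v :=
  ENNReal.toReal_nonneg

lemma playExpect_nonneg (i : Fin I.numArms) (v : Fin (I.arm i).card)
    {f : Fin (I.arm i).card → ℝ} (h : ∀ w, 0 ≤ f w) : 0 ≤ I.playExpect i v f :=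
  Finset.sum_nonneg fun w _ => mul_nonneg measureReal_nonneg (h w)

lemma expectedReward_of_none {π : I.Policy} {x : I.Position} (h : π x = none) (t : ℕ) :
    I.expectedReward π t x = 0 := by
  cases t <;> simp [expectedReward, h]

lemma expectedReward_of_some {π : I.Policy} {x : I.Position} {i : Fin I.numArms}
    (h : π x = some i) (t : ℕ) :
    I.expectedReward π (t + 1) x = I.playReward i (x i).1 + I.playExpect i (x i).1 fun w =>
      I.expectedReward π t (Function.update x i (w, (x i).2 + 1)) := by
  simp [expectedReward, h]

lemma expectedReward_nonneg (π : I.Policy) (t : ℕ) (x : I.Position) :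
    0 ≤ I.expectedReward π t x := by
  induction t generalizing x with
  | zero => exact le_rfl
  | succ t ih =>
    rcases h : π x with _ | i
    · rw [expectedReward_of_none h]
    · rw [expectedReward_of_some h]
      exact add_nonneg (playReward_nonneg _ _) (playExpect_nonneg _ _ fun w => ih _)

lemma measurable_rewardFrom_advance {π : I.Policy} {t : ℕ}
    (h : ∀ x, Measurable fun θ => I.rewardFrom π θ t x) (x : I.Position) (i : Fin I.numArms) :
    Measurable fun p : (∀ i, (I.arm i).Θ) × ℝ≥0 =>
      min (p.2 : ℝ≥0∞) ((I.arm i).remaining (x i).1)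
        + I.rewardFrom π p.1 t (I.advance x i p.2) := by
  refine Measurable.add ?_ ?_
  · exact (measurable_coe_nnreal_ennreal.comp measurable_snd).min measurable_const
  · have h1 : Measurable fun p : (∀ i, (I.arm i).Θ) × Fin (I.arm i).card =>
        I.rewardFrom π p.1 t (Function.update x i (p.2, (x i).2 + 1)) :=
      measurable_from_prod_countable_left fun w =>
        h (Function.update x i (w, (x i).2 + 1))
    exact h1.comp (measurable_fst.prodMk (((I.arm i).measurable_next _).comp measurable_snd))

lemma measurable_rewardFrom (π : I.Policy) (t : ℕ) (x : I.Position) :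
    Measurable fun θ => I.rewardFrom π θ t x := by
  induction t generalizing x with
  | zero => exact measurable_const
  | succ t ih =>
    rcases h : π x with _ | i
    · simp only [rewardFrom, h]; exact measurable_const
    · simp only [rewardFrom, h]
      exact Measurable.lintegral_kernel_prod_right'
        (κ := (I.arm i).law.comap (fun θ : ∀ i, (I.arm i).Θ => θ i) (measurable_pi_apply i))
        (measurable_rewardFrom_advance ih x i)

/-- The expected reward under the product of the posteriors follows the recursion of a Markov
decision process on the positions. -/
theorem lintegral_rewardFrom (π : I.Policy) (t : ℕ) (x : I.Position)
    (hx : ∀ i, (I.arm i).Reach (x i).2 (x i).1) (ht : ∑ i, (x i).2 + t ≤ I.horizon) :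
    ∫⁻ θ, I.rewardFrom π θ t x ∂(Measure.pi fun i => ((I.arm i).post (x i).1 : Measure _)) =
      ENNReal.ofReal (I.expectedReward π t x) := by
  induction t generalizing x with
  | zero => simp [rewardFrom, expectedReward]
  | succ t ih =>
    rcases h : π x with _ | i
    · simp [rewardFrom, expectedReward, h]
    have hki : (x i).2 < I.horizon := by
      have := Finset.single_le_sum (f := fun i => (x i).2) (fun _ _ => Nat.zero_le _)
        (Finset.mem_univ i)
      omega
    set A := I.arm i with hA
    have hpost := I.isPosteriorSpace i
    set μ : ∀ j, Measure (I.arm j).Θ := fun j => ((I.arm j).post (x j).1 : Measure _) with hμ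
    let f : (∀ i, (I.arm i).Θ) × ℝ≥0 → ℝ≥0∞ := fun p =>
      min (p.2 : ℝ≥0∞) (A.remaining (x i).1) + I.rewardFrom π p.1 t (I.advance x i p.2)
    have hf : Measurable f :=
      measurable_rewardFrom_advance (measurable_rewardFrom π t) x i
    have hupd := measurable_update_prod (α := fun i => (I.arm i).Θ) i
    let H : A.Θ × ℝ≥0 → ℝ≥0∞ := fun p =>
      ∫⁻ θ, f (Function.update θ i p.1, p.2) ∂(Measure.pi μ)
    have hH : Measurable H := by
      refine Measurable.lintegral_prod_right'
        (f := fun q : (A.Θ × ℝ≥0) × (∀ i, (I.arm i).Θ) =>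
          f (Function.update q.2 i q.1.1, q.1.2)) ?_
      exact hf.comp ((hupd.comp ((measurable_fst.comp measurable_fst).prodMk measurable_snd)).prodMk
        (measurable_snd.comp measurable_fst))
    -- resample the parameter of arm `i`, exchange the integrals, and apply Bayes' rule
    have h1 : ∫⁻ θ, I.rewardFrom π θ (t + 1) x ∂(Measure.pi μ) =
        ∫⁻ y, ∫⁻ s, H (s, y) ∂((A.law†(μ i)) y) ∂(A.outcome (x i).1) := by
      have e : ∀ θ, I.rewardFrom π θ (t + 1) x = ∫⁻ y, f (θ, y) ∂(A.law (θ i)) := by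
        intro θ; simp only [rewardFrom, h]; rfl
      rw [lintegral_pi_eq_resample μ μ i (fun _ _ => rfl) (measurable_rewardFrom π (t + 1) x)]
      have : ∀ s, ∫⁻ θ, I.rewardFrom π (Function.update θ i s) (t + 1) x ∂(Measure.pi μ) =
          ∫⁻ y, H (s, y) ∂(A.law s) := by
        intro s
        simp only [e, Function.update_self]
        refine lintegral_lintegral_swap (Measurable.aemeasurable ?_)
        exact hf.comp ((hupd.comp (measurable_const.prodMk measurable_fst)).prodMk measurable_snd)
      simp only [this]
      exact lintegral_lintegral_posterior A.law (μ i) hH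
    have h2 : ∀ᵐ y ∂(A.outcome (x i).1), ∫⁻ s, H (s, y) ∂((A.law†(μ i)) y) =
        min (y : ℝ≥0∞) (A.remaining (x i).1) + ENNReal.ofReal
          (I.expectedReward π t (Function.update x i (A.next (x i).1 y, (x i).2 + 1))) := by
      filter_upwards [hpost.bayes _ hki _ (hx i), Arm.ae_reach (hx i)] with y hy hr
      have hsum : ∑ j, (I.advance x i y j).2 = ∑ j, (x j).2 + 1 := by
        rw [← Finset.add_sum_erase _ _ (Finset.mem_univ i),
          ← Finset.add_sum_erase _ (fun j => (x j).2) (Finset.mem_univ i)]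
        have : ∑ j ∈ Finset.univ.erase i, (I.advance x i y j).2 =
            ∑ j ∈ Finset.univ.erase i, (x j).2 :=
          Finset.sum_congr rfl fun j hj => by
            rw [advance, Function.update_of_ne (Finset.ne_of_mem_erase hj)]
        rw [this, advance, Function.update_self]
        ring
      have hi := ih (I.advance x i y) (fun j => by
        by_cases hj : j = i
        · subst hj; simpa [advance] using hr
        · simpa [advance, Function.update_of_ne hj] using hx j) (by omega)
      have hres := lintegral_pi_eq_resample μ
        (fun j => ((I.arm j).post (I.advance x i y j).1 : Measure _)) i
        (fun j hj => by simp only [advance, Function.update_of_ne hj, hμ])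
        (F := fun θ => f (θ, y)) (hf.comp (measurable_id.prodMk measurable_const))
      have hyi : ((I.arm i).post (I.advance x i y i).1 : Measure _) = (A.law†(μ i)) y := by
        simp only [advance, Function.update_self]; exact hy
      rw [hyi] at hres
      change ∫⁻ s, ∫⁻ θ, f (Function.update θ i s, y) ∂(Measure.pi μ) ∂((A.law†(μ i)) y) = _
      rw [← hres]
      simp only [f]
      rw [lintegral_add_left measurable_const, hi, lintegral_const, measure_univ, mul_one]
      rfl
    rw [h1, lintegral_congr_ae h2, lintegral_add_left
      (measurable_coe_nnreal_ennreal.min measurable_const),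
      Arm.lintegral_next (x i).1 (fun w => ENNReal.ofReal
          (I.expectedReward π t (Function.update x i (w, (x i).2 + 1)))),
      expectedReward_of_some h, ENNReal.ofReal_add (playReward_nonneg _ _)
        (playExpect_nonneg _ _ fun w => expectedReward_nonneg _ _ _)]
    congr 1
    · exact (ENNReal.ofReal_toReal (hpost.finite _ hki _ (hx i))).symm
    · rw [playExpect, ENNReal.ofReal_sum_of_nonneg
        fun w _ => mul_nonneg measureReal_nonneg (expectedReward_nonneg _ _ _)]
      refine Finset.sum_congr rfl fun w _ => ?_
      rw [ENNReal.ofReal_mul measureReal_nonneg, ofReal_measureReal, mul_comm]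

theorem value_eq (π : I.Policy) :
    I.value π = ENNReal.ofReal (I.expectedReward π I.horizon I.start) :=
  lintegral_rewardFrom π I.horizon I.start (fun _ => rfl) (by simp [start])

variable (I)

/-! ### The arms as one Markov chain -/

/-- The disjoint union of the state spaces of all arms, as a Markov chain read off the input. -/
noncomputable def chain : Chain where
  horizon := I.horizon
  size := I.totalStates
  reward := fun g => I.input.real 0 g
  trans := fun g h => I.input.real 1 (g * I.totalStates + h)

/-- The number of the state `v` of arm `i`. -/
def code (i : Fin I.numArms) (v : Fin (I.arm i).card) : ℕ := I.number ⟨i, v⟩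

variable {I}

lemma code_lt (i : Fin I.numArms) (v : Fin (I.arm i).card) : I.code i v < I.chain.size :=
  (I.number ⟨i, v⟩).isLt

lemma exists_code_eq {g : ℕ} (hg : g < I.chain.size) : ∃ i v, I.code i v = g :=
  ⟨(I.number.symm ⟨g, hg⟩).1, (I.number.symm ⟨g, hg⟩).2, by simp [code]⟩

lemma code_injective {i j : Fin I.numArms} {v : Fin (I.arm i).card} {w : Fin (I.arm j).card}
    (h : I.code i v = I.code j w) : (⟨i, v⟩ : I.State) = ⟨j, w⟩ :=
  I.number.injective (Fin.ext h)

lemma chain_reward_code (i : Fin I.numArms) (v : Fin (I.arm i).card) :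
    I.chain.reward (I.code i v) = I.playReward i v := by
  have h : I.code i v < I.totalStates := code_lt i v
  have : I.number.symm ⟨I.code i v, h⟩ = ⟨i, v⟩ := by simp [code]
  simp only [chain, input, h, dif_pos]
  rw [this]
  rfl

lemma chain_trans_code (i j : Fin I.numArms) (v : Fin (I.arm i).card) (w : Fin (I.arm j).card) :
    I.chain.trans (I.code i v) (I.code j w) = I.transition ⟨i, v⟩ ⟨j, w⟩ := by
  have h1 : I.code i v < I.totalStates := code_lt i v
  have h2 : I.code j w < I.totalStates := code_lt j w
  have h : I.code i v * I.totalStates + I.code j w < I.totalStates * I.totalStates := by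
    nlinarith
  have h3 : finProdFinEquiv.symm ⟨I.code i v * I.totalStates + I.code j w, h⟩ =
      (I.number ⟨i, v⟩, I.number ⟨j, w⟩) := by
    rw [Equiv.symm_apply_eq]
    ext
    simp [finProdFinEquiv, code]
    ring
  simp only [chain, input, h, dif_pos]
  rw [h3]
  simp

lemma transition_same (i : Fin I.numArms) (v w : Fin (I.arm i).card) :
    I.transition ⟨i, v⟩ ⟨i, w⟩ = ((I.arm i).outcome v).real {y | (I.arm i).next v y = w} := by
  simp [transition]

lemma transition_of_ne {i j : Fin I.numArms} (h : i ≠ j) (v : Fin (I.arm i).card)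
    (w : Fin (I.arm j).card) : I.transition ⟨i, v⟩ ⟨j, w⟩ = 0 := by
  have : {y | (⟨i, (I.arm i).next v y⟩ : I.State) = ⟨j, w⟩} = ∅ :=
    Set.eq_empty_of_forall_notMem fun y hy => h (congrArg Sigma.fst hy)
  simp only [transition]
  rw [this, measureReal_empty]

lemma chain_expect_code (f : ℕ → ℝ) (i : Fin I.numArms) (v : Fin (I.arm i).card) :
    I.chain.expect f (I.code i v) = I.playExpect i v fun w => f (I.code i w) := by
  rw [Chain.expect, Finset.sum_range]
  change ∑ h : Fin I.totalStates, _ = _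
  rw [← Equiv.sum_comp I.number, Fintype.sum_sigma, Finset.sum_eq_single i]
  · refine Finset.sum_congr rfl fun w _ => ?_
    rw [← transition_same, ← chain_trans_code]
    rfl
  · intro j _ hj
    refine Finset.sum_eq_zero fun w _ => ?_
    have := (chain_trans_code i j v w).trans (transition_of_ne hj.symm v w)
    rw [code, code] at this
    rw [code, this, zero_mul]
  · simp

lemma sum_outcome (i : Fin I.numArms) (v : Fin (I.arm i).card) :
    ∑ w, ((I.arm i).outcome v).real {y | (I.arm i).next v y = w} = 1 := by
  have h := Arm.lintegral_next (A := I.arm i) v fun _ => 1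
  simp only [lintegral_const, measure_univ, one_mul] at h
  have h' := congrArg ENNReal.toReal h
  rw [ENNReal.toReal_sum fun _ _ => measure_ne_top _ _] at h'
  simpa [measureReal_def] using h'.symm

lemma chain_valid : I.chain.Valid where
  reward_nonneg g hg := by
    obtain ⟨i, v, rfl⟩ := exists_code_eq hg
    rw [chain_reward_code]
    exact playReward_nonneg i v
  trans_nonneg g hg h hh := by
    obtain ⟨i, v, rfl⟩ := exists_code_eq hg
    obtain ⟨j, w, rfl⟩ := exists_code_eq hh
    rw [chain_trans_code]
    exact measureReal_nonneg
  trans_sum g hg := by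
    obtain ⟨i, v, rfl⟩ := exists_code_eq hg
    have := chain_expect_code (fun _ => 1) i v
    simpa [Chain.expect, playExpect, sum_outcome] using this

lemma trans_ne_zero {i : Fin I.numArms} {v : Fin (I.arm i).card} {h : ℕ} (hh : h < I.chain.size)
    (h0 : I.chain.trans (I.code i v) h ≠ 0) :
    ∃ w, I.code i w = h ∧ (I.arm i).outcome v {y | (I.arm i).next v y = w} ≠ 0 := by
  obtain ⟨j, w, rfl⟩ := exists_code_eq hh
  rw [chain_trans_code] at h0
  obtain rfl : i = j := by
    by_contra hij
    exact h0 (transition_of_ne hij v w)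
  rw [transition_same] at h0
  exact ⟨w, rfl, fun h => h0 (by simp [measureReal_def, h])⟩

lemma chain_decreasing :
    I.chain.Decreasing fun k g => ∃ i v, I.code i v = g ∧ (I.arm i).Reach k v where
  step := by
    rintro k hk _ hg ⟨i, v, rfl, hv⟩ h hh h0
    obtain ⟨w, hw, hw0⟩ := trans_ne_zero hh h0
    exact ⟨i, w, hw, v, hv, hw0⟩
  reward := by
    rintro k hk _ hg ⟨i, v, rfl, hv⟩
    have hk' : k < I.horizon := Nat.lt_of_succ_lt hk
    have hle := Arm.lintegral_reward_next_le (I.isPosteriorSpace i) hk' hv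
    rw [Arm.lintegral_next v (I.arm i).reward] at hle
    have hfin := (I.isPosteriorSpace i).finite k hk' v hv
    have := ENNReal.toReal_mono hfin hle
    rw [ENNReal.toReal_sum fun w hw =>
      ne_top_of_le_ne_top hfin ((Finset.single_le_sum (fun _ _ => zero_le) hw).trans hle)] at this
    rw [chain_expect_code, chain_reward_code, playExpect]
    refine le_trans (le_of_eq (Finset.sum_congr rfl fun w _ => ?_)) this
    rw [chain_reward_code, ENNReal.toReal_mul, mul_comm]
    rfl

lemma playExpect_add (i : Fin I.numArms) (v : Fin (I.arm i).card) (c : ℝ)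
    (f : Fin (I.arm i).card → ℝ) :
    I.playExpect i v (fun w => c + f w) = c + I.playExpect i v f := by
  simp [playExpect, mul_add, Finset.sum_add_distrib, ← Finset.sum_mul, sum_outcome]

lemma playExpect_mono (i : Fin I.numArms) (v : Fin (I.arm i).card)
    {f f' : Fin (I.arm i).card → ℝ} (h : ∀ w, f w ≤ f' w) :
    I.playExpect i v f ≤ I.playExpect i v f' :=
  Finset.sum_le_sum fun w _ => mul_le_mul_of_nonneg_left (h w) measureReal_nonneg

lemma lt_horizon_of_sum {x : I.Position} (h : ∑ i, (x i).2 < I.horizon) (i : Fin I.numArms) :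
    (x i).2 < I.horizon :=
  (Finset.single_le_sum (f := fun i => (x i).2) (fun _ _ => Nat.zero_le _)
    (Finset.mem_univ i)).trans_lt h

lemma sum_update_plays (x : I.Position) (i : Fin I.numArms) (w : Fin (I.arm i).card) :
    ∑ j, (Function.update x i (w, (x i).2 + 1) j).2 = ∑ j, (x j).2 + 1 := by
  rw [← Finset.add_sum_erase _ _ (Finset.mem_univ i),
    ← Finset.add_sum_erase _ (fun j => (x j).2) (Finset.mem_univ i), Function.update_self]
  have : ∀ j ∈ Finset.univ.erase i, (Function.update x i (w, (x i).2 + 1) j).2 = (x j).2 :=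
    fun j hj => by rw [Function.update_of_ne (Finset.ne_of_mem_erase hj)]
  rw [Finset.sum_congr rfl this]
  ring

/-! ### The upper bound by duality -/

/-- If each play is charged `a`, the arms decouple: the reward of any policy is at most the total
charge plus the sum of the optimal net rewards of the arms. -/
theorem expectedReward_le {C : ℕ → ℕ → Prop} {a : ℝ} (ha : 0 ≤ a) (hC : I.chain.Optimal C a)
    (π : I.Policy) (t : ℕ) (x : I.Position) (hx : ∑ i, (x i).2 + t ≤ I.horizon) :
    I.expectedReward π t x ≤ a * t + ∑ i,
      I.chain.total C (fun g => I.chain.reward g - a) (x i).2 (I.code i (x i).1) := by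
  set W := I.chain.total C fun g => I.chain.reward g - a with hW
  have h0 : ∀ x : I.Position, 0 ≤ ∑ i, W (x i).2 (I.code i (x i).1) := fun x =>
    Finset.sum_nonneg fun i _ => hC.total_nonneg (code_lt _ _)
  induction t generalizing x with
  | zero => simpa [expectedReward] using h0 x
  | succ t ih =>
    rcases h : π x with _ | i
    · rw [expectedReward_of_none h]
      exact add_nonneg (mul_nonneg ha (Nat.cast_nonneg _)) (h0 x)
    rw [expectedReward_of_some h]
    set B := ∑ j ∈ Finset.univ.erase i, W (x j).2 (I.code j (x j).1) with hB
    have hstep : ∀ w, I.expectedReward π t (Function.update x i (w, (x i).2 + 1)) ≤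
        (a * t + B) + W ((x i).2 + 1) (I.code i w) := by
      intro w
      refine (ih _ (by rw [sum_update_plays]; omega)).trans (le_of_eq ?_)
      rw [← Finset.add_sum_erase _ _ (Finset.mem_univ i), Function.update_self, hB]
      have : ∀ j ∈ Finset.univ.erase i, W (Function.update x i (w, (x i).2 + 1) j).2
          (I.code j (Function.update x i (w, (x i).2 + 1) j).1) = W (x j).2 (I.code j (x j).1) :=
        fun j hj => by rw [Function.update_of_ne (Finset.ne_of_mem_erase hj)]
      rw [Finset.sum_congr rfl this]
      ring
    have h1 := playExpect_mono i (x i).1 hstep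
    rw [playExpect_add, ← chain_expect_code (W ((x i).2 + 1))] at h1
    have h2 := hC.cont_le_total (k := (x i).2) (lt_horizon_of_sum (by omega) i)
      (code_lt i (x i).1)
    rw [Chain.cont, chain_reward_code, ← hW] at h2
    rw [← Finset.add_sum_erase _ _ (Finset.mem_univ i), ← hB]
    push_cast
    linarith

/-! ### The lower bound for the index policy -/

variable (I) in
/-- The number of the initial state of arm `j`. -/
noncomputable def rootCode (j : ℕ) : ℕ := I.input.nat 2 j

lemma rootCode_eq (i : Fin I.numArms) : I.rootCode i = I.code i (I.arm i).root := by
  simp [rootCode, input, code]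

variable (I) in
/-- The expected reward of the stopping rule `C` from the initial state of arm `j`. -/
noncomputable def armReward (C : ℕ → ℕ → Prop) (j : ℕ) : ℝ :=
  I.chain.total C I.chain.reward 0 (I.rootCode j)

variable (I) in
/-- The expected number of plays of the stopping rule `C` from the initial state of arm `j`. -/
noncomputable def armPlays (C : ℕ → ℕ → Prop) (j : ℕ) : ℝ :=
  I.chain.total C (fun _ => 1) 0 (I.rootCode j)

variable (I) in
/-- A decision `d` in position `x` follows the indices `κ` within the stopping rule `C`: quit if
the rule stops all arms, otherwise play the arm of largest index that is not stopped (the first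
one in case of a tie). -/
def IndexChoice (C : ℕ → ℕ → Prop) (κ : ℕ → ℝ) (x : I.Position) (d : Option (Fin I.numArms)) :
    Prop :=
  (d = none ∧ ∀ j, ¬ C (x j).2 (I.code j (x j).1)) ∨
  ∃ i, d = some i ∧ C (x i).2 (I.code i (x i).1) ∧
    ∀ j, C (x j).2 (I.code j (x j).1) → κ j ≤ κ i ∧ (j < i → κ j < κ i)

lemma rootCode_lt (i : Fin I.numArms) : I.rootCode i < I.chain.size := by
  rw [rootCode_eq]; exact code_lt _ _

lemma armReward_nonneg (C : ℕ → ℕ → Prop) (i : Fin I.numArms) : 0 ≤ I.armReward C i :=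
  Chain.run_nonneg chain_valid chain_valid.reward_nonneg _ _ (rootCode_lt i)

lemma armPlays_nonneg (C : ℕ → ℕ → Prop) (i : Fin I.numArms) : 0 ≤ I.armPlays C i :=
  Chain.run_nonneg chain_valid (by simp) _ _ (rootCode_lt i)

lemma armReward_eq_mul (C : ℕ → ℕ → Prop) (i : Fin I.numArms) :
    I.armReward C i = I.armReward C i / I.armPlays C i * I.armPlays C i := by
  by_cases h : C 0 (I.rootCode i)
  · by_cases hT : 0 < I.chain.horizon
    · have := Chain.one_le_cont chain_valid C 0 (rootCode_lt i)
      rw [div_mul_cancel₀]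
      rw [armPlays, Chain.total_of_mem hT h]
      exact (zero_lt_one.trans_le this).ne'
    · simp [armReward, Chain.total_horizon (not_lt.1 hT)]
  · simp [armReward, Chain.total_of_not_mem h]

/-- The expected reward of the index policy from a position in which the arms of `U` have not been
played and all other arms are stopped. The arm `a` of largest index in `U` is played until it
stops; while it runs, the bound deducts from the time left for the other arms of `U` the expected
number of plays that `a` is still to receive. -/
lemma le_expectedReward {C : ℕ → ℕ → Prop} {π : I.Policy}
    (hπ : ∀ x : I.Position, ∑ i, (x i).2 < I.horizon →
      I.IndexChoice C (fun j => I.armReward C j / I.armPlays C j) x (π x))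
    (U : Finset (Fin I.numArms)) :
    ∀ (t : ℕ) (x : I.Position), ∑ i, (x i).2 + t ≤ I.horizon →
      (∀ i ∈ U, x i = I.start i) → (∀ i ∉ U, ¬ C (x i).2 (I.code i (x i).1)) →
      t * ∑ i ∈ U, I.armReward C i -
        (∑ i ∈ U, ∑ j ∈ U, loss (I.armReward C) (I.armPlays C) i j) / 2 ≤
      I.horizon * I.expectedReward π t x := by
  set κ : ℕ → ℝ := fun j => I.armReward C j / I.armPlays C j with hκ
  induction U using Finset.induction_on_max_value
    (f := fun i : Fin I.numArms => toLex (κ i, OrderDual.toDual i)) with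
  | empty =>
    intro t x _ _ _
    simpa using mul_nonneg (Nat.cast_nonneg I.horizon) (expectedReward_nonneg π t x)
  | insert a U haU hmax ih =>
    set α := ∑ i ∈ U, I.armReward C i with hα
    set ℓ := ∑ i ∈ U, ∑ j ∈ U, loss (I.armReward C) (I.armPlays C) i j with hℓ
    have hα0 : 0 ≤ α := Finset.sum_nonneg fun i _ => armReward_nonneg C i
    have hℓ0 : 0 ≤ ℓ := by
      refine Finset.sum_nonneg fun i _ => Finset.sum_nonneg fun j _ => ?_
      rw [loss]
      split_ifs
      · exact le_rfl
      · exact le_min (mul_nonneg (armReward_nonneg C i) (armPlays_nonneg C j))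
          (mul_nonneg (armReward_nonneg C j) (armPlays_nonneg C i))
    have running : ∀ (t : ℕ) (x : I.Position), ∑ i, (x i).2 + t ≤ I.horizon →
        (∀ i ∈ U, x i = I.start i) →
        (∀ i ∉ insert a U, ¬ C (x i).2 (I.code i (x i).1)) →
        I.horizon * I.chain.run C I.chain.reward t (x a).2 (I.code a (x a).1) +
          α * (t - I.chain.total C (fun _ => 1) (x a).2 (I.code a (x a).1)) - ℓ / 2 ≤
        I.horizon * I.expectedReward π t x := by
      intro t
      induction t with
      | zero =>
        intro x _ _ _
        have := Chain.run_nonneg (C := C) (w := fun _ => 1) chain_valid (by simp)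
          (I.chain.horizon - (x a).2) (x a).2 (code_lt a (x a).1)
        have h2 := mul_nonneg hα0 this
        simp only [Chain.run, expectedReward, Chain.total] at *
        push_cast
        linarith
      | succ t iht =>
        intro x hx hstart hidle
        by_cases hCa : C (x a).2 (I.code a (x a).1)
        · have hπa : π x = some a := by
            rcases hπ x (by omega) with ⟨-, hnone⟩ | ⟨b, hb, hCb, hbmax⟩
            · exact absurd hCa (hnone a)
            · rw [hb]
              by_contra hne
              have hba : b ≠ a := fun h => hne (by rw [h])
              have hbU : b ∈ U := by
                by_contra hbU
                exact hidle b (by simp [hba, hbU]) hCb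
              have h1 := hbmax a hCa
              have h2 := hmax b hbU
              rw [Prod.Lex.toLex_le_toLex] at h2
              rcases h2 with h2 | ⟨h2, h3⟩
              · exact absurd h2 (not_lt.2 h1.1)
              · have h3' : a ≤ b := h3
                exact (h1.2 (lt_of_le_of_ne h3' hba.symm)).ne' h2
          have hka := lt_horizon_of_sum (x := x) (by omega) a
          rw [expectedReward_of_some hπa, Chain.run_of_mem hCa, Chain.total_of_mem hka hCa,
            Chain.cont, chain_reward_code]
          have hstep : ∀ w, (-(ℓ / 2) + α * t) + (I.horizon *
              I.chain.run C I.chain.reward t ((x a).2 + 1) (I.code a w) -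
                α * I.chain.total C (fun _ => 1) ((x a).2 + 1) (I.code a w)) ≤
              I.horizon * I.expectedReward π t (Function.update x a (w, (x a).2 + 1)) := by
            intro w
            have hi := iht (Function.update x a (w, (x a).2 + 1))
              (by rw [sum_update_plays]; omega)
              (fun i hi => by
                rw [Function.update_of_ne (ne_of_mem_of_not_mem hi haU)]; exact hstart i hi)
              (fun i hi => by
                rw [Function.update_of_ne
                  (ne_of_mem_of_not_mem (Finset.mem_insert_self a U) hi).symm]
                exact hidle i hi)
            rw [Function.update_self] at hi
            linarith
          have h1 := playExpect_mono a (x a).1 hstep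
          rw [playExpect_add, ← chain_expect_code (fun h => I.horizon *
              I.chain.run C I.chain.reward t ((x a).2 + 1) h -
                α * I.chain.total C (fun _ => 1) ((x a).2 + 1) h), Chain.expect_sub,
            Chain.expect_const_mul, Chain.expect_const_mul] at h1
          have h2 : I.playExpect a (x a).1 (fun w => (I.horizon : ℝ) *
              I.expectedReward π t (Function.update x a (w, (x a).2 + 1))) =
              I.horizon * I.playExpect a (x a).1 fun w =>
                I.expectedReward π t (Function.update x a (w, (x a).2 + 1)) := by
            simp only [playExpect, Finset.mul_sum]
            exact Finset.sum_congr rfl fun _ _ => by ring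
          rw [h2] at h1
          push_cast
          linarith
        · rw [Chain.run_of_not_mem hCa, Chain.total_of_not_mem hCa]
          have := ih (t + 1) x hx hstart fun i hi => by
            by_cases hia : i = a
            · subst hia; exact hCa
            · exact hidle i (by simp [hia, hi])
          push_cast at this ⊢
          linarith
    intro t x hx hstart hidle
    have hrun := running t x hx (fun i hi => hstart i (Finset.mem_insert_of_mem hi)) hidle
    rw [hstart a (Finset.mem_insert_self a U)] at hrun
    simp only [start, ← rootCode_eq] at hrun
    have htrunc := Chain.mul_total_le_mul_run chain_valid chain_decreasing (C := C) (t := t)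
      (show t ≤ I.chain.horizon from (by omega : t ≤ I.horizon)) (rootCode_lt a)
      ⟨a, (I.arm a).root, (rootCode_eq a).symm, rfl⟩
    have hloss : ∀ j ∈ U, loss (I.armReward C) (I.armPlays C) a j =
          I.armPlays C a * I.armReward C j ∧
        loss (I.armReward C) (I.armPlays C) j a = I.armPlays C a * I.armReward C j := by
      intro j hj
      have hja : j ≠ a := fun h => haU (h ▸ hj)
      have hne : (j : ℕ) ≠ a := fun h => hja (Fin.ext h)
      have hle : κ j ≤ κ a := by
        have := hmax j hj
        rw [Prod.Lex.toLex_le_toLex] at this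
        rcases this with h | ⟨h, -⟩
        · exact h.le
        · exact h.le
      have hmul : I.armReward C j * I.armPlays C a ≤ I.armReward C a * I.armPlays C j := by
        rw [armReward_eq_mul C j, armReward_eq_mul C a]
        have := mul_le_mul_of_nonneg_right hle
          (mul_nonneg (armPlays_nonneg C j) (armPlays_nonneg C a))
        simp only [hκ] at this
        linarith
      rw [loss, loss, if_neg hne, if_neg hne.symm, min_eq_left hmul, min_eq_right hmul]
      exact ⟨mul_comm _ _, mul_comm _ _⟩
    have hsum : ∑ i ∈ insert a U, ∑ j ∈ insert a U, loss (I.armReward C) (I.armPlays C) i j =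
        ℓ + 2 * (I.armPlays C a * α) := by
      simp only [Finset.sum_insert haU, Finset.sum_add_distrib]
      rw [Finset.sum_congr rfl fun j hj => (hloss j hj).1,
        Finset.sum_congr rfl fun j hj => (hloss j hj).2, ← Finset.mul_sum]
      simp only [loss, if_true, hα, hℓ]
      ring
    rw [hsum, Finset.sum_insert haU, ← hα]
    change t * I.armReward C a ≤ (I.horizon : ℝ) * _ at htrunc
    change _ + α * (t - I.armPlays C a) - _ ≤ _ at hrun
    linarith

variable (I) in
/-- The score of the stopping rule `C`, applied to all arms. -/
noncomputable def ruleScore (C : ℕ → ℕ → Prop) : ℝ :=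
  score I.numArms I.horizon (I.armReward C) (I.armPlays C)

theorem ruleScore_le {C : ℕ → ℕ → Prop} {π : I.Policy}
    (hπ : ∀ x : I.Position, ∑ i, (x i).2 < I.horizon →
      I.IndexChoice C (fun j => I.armReward C j / I.armPlays C j) x (π x)) :
    I.ruleScore C ≤ 2 * I.horizon * I.expectedReward π I.horizon I.start := by
  have := le_expectedReward hπ Finset.univ I.horizon I.start (by simp [start])
    (fun _ _ => rfl) (by simp)
  rw [ruleScore, score_eq]
  simp only [Finset.sum_range]
  linarith

/-! ### The factor two -/

/-- The index policy of the greedy stage of largest score collects half of the optimum. -/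
theorem optimum_div_two_le_value {o : ℕ → ℕ} {b : ℕ} {π : I.Policy}
    (ho : ∀ c, c < I.chain.horizon * I.chain.size → I.chain.GreedyStep o c)
    (hb : ∀ c ≤ I.chain.horizon * I.chain.size,
      I.ruleScore (I.chain.stage o c) ≤ I.ruleScore (I.chain.stage o b))
    (hπ : ∀ x : I.Position, ∑ i, (x i).2 < I.horizon →
      I.IndexChoice (I.chain.stage o b)
        (fun j => I.armReward (I.chain.stage o b) j / I.armPlays (I.chain.stage o b) j) x (π x)) :
    I.optimum / 2 ≤ I.value π := by
  suffices h : ∃ D : ℝ, (∀ π', I.expectedReward π' I.horizon I.start ≤ D) ∧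
      D / 2 ≤ I.expectedReward π I.horizon I.start by
    obtain ⟨D, hD, hD2⟩ := h
    have h1 : I.optimum ≤ ENNReal.ofReal D :=
      iSup_le fun π' => by rw [value_eq]; exact ENNReal.ofReal_le_ofReal (hD π')
    calc I.optimum / 2 ≤ ENNReal.ofReal D / 2 := ENNReal.div_le_div_right h1 2
      _ = ENNReal.ofReal (D / 2) := by
        rw [ENNReal.ofReal_div_of_pos two_pos, ENNReal.ofReal_ofNat]
      _ ≤ I.value π := by rw [value_eq]; exact ENNReal.ofReal_le_ofReal hD2
  rcases Nat.eq_zero_or_pos I.horizon with hT | hT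
  · exact ⟨0, by simp [hT, expectedReward], by simp [hT, expectedReward]⟩
  rcases Nat.eq_zero_or_pos I.numArms with hn | hn
  · have : ∀ π' : I.Policy, I.expectedReward π' I.horizon I.start = 0 := fun π' =>
      expectedReward_of_none (Option.eq_none_iff_forall_not_mem.2
        fun i _ => absurd i.isLt (by omega)) _
    exact ⟨0, fun π' => (this π').le, by simp [this]⟩
  set st := I.chain.stage o with hst
  set plays : ℕ → ℝ := fun c => ∑ i ∈ Finset.range I.numArms, I.armPlays (st c) i with hplays
  have hroot : ∀ i < I.numArms, I.rootCode i < I.chain.size := fun i hi => rootCode_lt ⟨i, hi⟩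
  have hfull : ∀ c, (∀ k < I.chain.horizon, ∀ g < I.chain.size, st c k g) →
      (I.horizon : ℝ) ≤ plays c := by
    intro c hc
    have h1 : ∀ i ∈ Finset.range I.numArms, I.armPlays (st c) i = I.horizon := fun i hi =>
      Chain.run_one_of_forall_mem chain_valid (hroot i (Finset.mem_range.1 hi))
        fun k hk g hg => hc k (by simpa using hk) g hg
    simp only [hplays]
    rw [Finset.sum_congr rfl h1, Finset.sum_const, Finset.card_range, nsmul_eq_mul]
    exact le_mul_of_one_le_left (Nat.cast_nonneg _) (by exact_mod_cast hn)
  -- the first stage with at least `horizon` expected plays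
  obtain ⟨c, hc, hcmin⟩ : ∃ c, (I.horizon : ℝ) ≤ plays c ∧
      ∀ c' < c, ¬ (I.horizon : ℝ) ≤ plays c' := by
    classical
    have hex : ∃ c, (I.horizon : ℝ) ≤ plays c := ⟨_, hfull _ (Chain.stage_full ho)⟩
    exact ⟨Nat.find hex, Nat.find_spec hex, fun c' hc' => Nat.find_min hex hc'⟩
  have hcle : c ≤ I.chain.horizon * I.chain.size := by
    by_contra hlt
    exact hcmin _ (not_le.1 hlt) (hfull _ (Chain.stage_full ho))
  obtain ⟨c, rfl⟩ : ∃ c', c = c' + 1 := by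
    refine Nat.exists_eq_succ_of_ne_zero fun h0 => ?_
    subst h0
    have h0 : plays 0 = 0 := Finset.sum_eq_zero fun i _ =>
      Chain.total_of_not_mem (by simp only [hst, Chain.stage]; omega)
    rw [h0] at hc
    exact absurd hc (not_le.2 (by exact_mod_cast hT))
  have hlt : plays c < I.horizon := not_le.1 (hcmin c (Nat.lt_succ_self c))
  have hnot : ¬ ∀ k < I.chain.horizon, ∀ g < I.chain.size, st c k g := fun h =>
    hcmin c (Nat.lt_succ_self c) (hfull c h)
  obtain ⟨a, ha, hopt, hopt'⟩ := Chain.exists_optimal_stage chain_valid (o := o) (c := c + 1)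
    fun c' hc' => ho c' (by omega)
  replace hopt' := hopt' c rfl hnot
  rcases ho c (by omega) with h | ⟨k₀, hk₀, g₀, hg₀, hn₀, hins, -⟩
  · exact absurd h hnot
  obtain ⟨m, v₀, rfl⟩ := exists_code_eq hg₀
  have hother : ∀ w, ∀ i < I.numArms, i ≠ m → I.chain.total (st (c + 1)) w 0 (I.rootCode i) =
      I.chain.total (st c) w 0 (I.rootCode i) := by
    intro w i hi him
    refine Chain.run_congr_of_closed (Q := fun g => ∃ v, I.code ⟨i, hi⟩ v = g) ?_ (hroot i hi)
      ⟨_, (rootCode_eq ⟨i, hi⟩).symm⟩ ?_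
    · rintro _ h ⟨v, rfl⟩ hh h0
      obtain ⟨w, hw, -⟩ := trans_ne_zero hh h0
      exact ⟨w, hw⟩
    · rintro k hk _ hg ⟨v, rfl⟩
      refine (hins k (by simpa using hk) _ hg).trans (or_iff_left fun h => him ?_)
      have := congrArg Sigma.fst (code_injective h.2)
      exact congrArg Fin.val this
  set W := ∑ i ∈ Finset.range I.numArms,
    I.chain.total (st c) (fun g => I.chain.reward g - a) 0 (I.rootCode i) with hW
  have hWc : ∀ c', ∑ i ∈ Finset.range I.numArms,
      I.chain.total (st c') (fun g => I.chain.reward g - a) 0 (I.rootCode i) =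
      ∑ i ∈ Finset.range I.numArms, I.armReward (st c') i - a * plays c' := by
    intro c'
    simp only [hplays, Finset.mul_sum, ← Finset.sum_sub_distrib]
    exact Finset.sum_congr rfl fun i _ => Chain.run_sub _ _ _ _ _ _
  have hW' : ∑ i ∈ Finset.range I.numArms,
      I.chain.total (st (c + 1)) (fun g => I.chain.reward g - a) 0 (I.rootCode i) = W :=
    Finset.sum_congr rfl fun i hi =>
      hopt'.total_eq hopt 0 (hroot i (Finset.mem_range.1 hi))
  have hscore : I.horizon * (a * I.horizon + W) ≤ I.ruleScore (st b) := by
    refine (mul_le_max_score (n := I.numArms) (m := m) (R := I.armReward (st c))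
      (τ := I.armPlays (st c)) (R' := I.armReward (st (c + 1))) (τ' := I.armPlays (st (c + 1)))
      (hother _) (hother _)
      (fun i hi => armReward_nonneg _ ⟨i, hi⟩) (fun i hi => armPlays_nonneg _ ⟨i, hi⟩)
      (fun i hi => armReward_nonneg _ ⟨i, hi⟩) (fun i hi => armPlays_nonneg _ ⟨i, hi⟩)
      (hWc c).symm ((hWc (c + 1)).symm.trans hW') hlt hc).trans ?_
    exact max_le (hb c (by omega)) (hb (c + 1) hcle)
  refine ⟨a * I.horizon + W, fun π' => ?_, ?_⟩
  · have := expectedReward_le ha hopt' π' I.horizon I.start (by simp [start])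
    rw [hW, Finset.sum_range]
    simpa only [start, rootCode_eq] using this
  · have h1 := hscore.trans (ruleScore_le hπ)
    have hT' : (0 : ℝ) < I.horizon := by exact_mod_cast hT
    have h2 : I.horizon * (a * I.horizon + W) ≤
        (I.horizon : ℝ) * (2 * I.expectedReward π I.horizon I.start) := by linarith
    linarith [le_of_mul_le_mul_left h2 hT']

end Instance

/-! ### Reasoning about programs -/

namespace Prog

/-- Started on `s`, the program halts after at most `b` steps on a memory that satisfies `Q`. -/
def Achieves (p : Prog) (s : Store) (b : ℕ) (Q : Store → Prop) : Prop :=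
  ∃ s' c, p.Runs s s' c ∧ c ≤ b ∧ Q s'

/-- Does the program contain an assignment to the natural-number array `a`? -/
def writesNat : Prog → ℕ → Bool
  | skip, _ => false
  | assignNat b _ _, a => a == b
  | assignReal _ _ _, _ => false
  | seq p q, a => p.writesNat a || q.writesNat a
  | ite _ p q, a => p.writesNat a || q.writesNat a
  | loop _ p, a => p.writesNat a

/-- Does the program contain an assignment to the real array `a`? -/
def writesReal : Prog → ℕ → Bool
  | skip, _ => false
  | assignNat _ _ _, _ => false
  | assignReal b _ _, a => a == b
  | seq p q, a => p.writesReal a || q.writesReal a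
  | ite _ p q, a => p.writesReal a || q.writesReal a
  | loop _ p, a => p.writesReal a

/-- The memories `s` and `s'` agree on all arrays that `p` does not write. -/
structure Agree (p : Prog) (s s' : Store) : Prop where
  nat : ∀ a, p.writesNat a = false → s'.nat a = s.nat a
  real : ∀ a, p.writesReal a = false → s'.real a = s.real a

lemma Agree.refl (p : Prog) (s : Store) : p.Agree s s := ⟨fun _ _ => rfl, fun _ _ => rfl⟩

lemma Agree.trans {p : Prog} {s s' s'' : Store} (h : p.Agree s s') (h' : p.Agree s' s'') :
    p.Agree s s'' :=
  ⟨fun a ha => (h'.nat a ha).trans (h.nat a ha), fun a ha => (h'.real a ha).trans (h.real a ha)⟩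

lemma Agree.of_subset {p q : Prog} {s s' : Store} (h : p.Agree s s')
    (hn : ∀ a, q.writesNat a = false → p.writesNat a = false)
    (hr : ∀ a, q.writesReal a = false → p.writesReal a = false) : q.Agree s s' :=
  ⟨fun a ha => h.nat a (hn a ha), fun a ha => h.real a (hr a ha)⟩

lemma Runs.agree {p : Prog} {s s' : Store} {c : ℕ} (h : p.Runs s s' c) : p.Agree s s' := by
  induction h with
  | skip s => exact .refl _ _
  | assignNat a i e s =>
    refine ⟨fun a' ha => funext fun j => ?_, fun _ _ => rfl⟩
    have : a' ≠ a := by simpa [writesNat] using ha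
    simp [Store.setNat, this]
  | assignReal a i e s =>
    refine ⟨fun _ _ => rfl, fun a' ha => funext fun j => ?_⟩
    have : a' ≠ a := by simpa [writesReal] using ha
    simp [Store.setReal, this]
  | seq _ _ ih ih' =>
    refine (ih.of_subset ?_ ?_).trans (ih'.of_subset ?_ ?_) <;>
      simp +contextual [writesNat, writesReal]
  | iteTrue _ _ ih => refine ih.of_subset ?_ ?_ <;> simp +contextual [writesNat, writesReal]
  | iteFalse _ _ ih => refine ih.of_subset ?_ ?_ <;> simp +contextual [writesNat, writesReal]
  | loopDone => exact .refl _ _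
  | @loopStep b p _ _ _ _ _ _ _ _ ih ih' =>
    exact (ih.of_subset (q := .loop b p) (fun _ h => h) (fun _ h => h)).trans ih'

lemma Achieves.mono {p : Prog} {s : Store} {b b' : ℕ} {Q Q' : Store → Prop}
    (h : p.Achieves s b Q) (hb : b ≤ b') (hQ : ∀ s', p.Agree s s' → Q s' → Q' s') :
    p.Achieves s b' Q' := by
  obtain ⟨s', c, hr, hc, hq⟩ := h
  exact ⟨s', c, hr, hc.trans hb, hQ s' hr.agree hq⟩

lemma Achieves.seq {p q : Prog} {s : Store} {b b' : ℕ} {Q Q' : Store → Prop}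
    (hp : p.Achieves s b Q) (hq : ∀ s', p.Agree s s' → Q s' → q.Achieves s' b' Q') :
    (Prog.seq p q).Achieves s (b + b') Q' := by
  obtain ⟨s', c, hr, hc, hQ⟩ := hp
  obtain ⟨s'', c', hr', hc', hQ'⟩ := hq s' hr.agree hQ
  exact ⟨s'', c + c', hr.seq hr', add_le_add hc hc', hQ'⟩

lemma Achieves.ite {t : Test} {p q : Prog} {s : Store} {b : ℕ} {Q : Store → Prop}
    (hp : t.Holds s → p.Achieves s b Q) (hq : ¬ t.Holds s → q.Achieves s b Q) :
    (Prog.ite t p q).Achieves s (t.cost + 1 + b) Q := by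
  by_cases h : t.Holds s
  · obtain ⟨s', c, hr, hc, hQ⟩ := hp h
    exact ⟨s', _, .iteTrue h hr, by omega, hQ⟩
  · obtain ⟨s', c, hr, hc, hQ⟩ := hq h
    exact ⟨s', _, .iteFalse h hr, by omega, hQ⟩

/-- The program contains no loops. -/
def loopFree : Prog → Bool
  | seq p q => p.loopFree && q.loopFree
  | ite _ p q => p.loopFree && q.loopFree
  | loop _ _ => false
  | _ => true

open Classical in
/-- The result of a program without loops. -/
noncomputable def exec : Prog → Store → Store
  | skip, s => s
  | assignNat a i e, s => s.setNat a (i.eval s) (e.eval s)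
  | assignReal a i e, s => s.setReal a (i.eval s) (e.eval s)
  | seq p q, s => q.exec (p.exec s)
  | ite b p q, s => if b.Holds s then p.exec s else q.exec s
  | loop _ _, s => s

/-- The largest number of steps of a program without loops. -/
def maxCost : Prog → ℕ
  | skip => 1
  | assignNat _ i e => i.cost + e.cost + 1
  | assignReal _ i e => i.cost + e.cost + 1
  | seq p q => p.maxCost + q.maxCost
  | ite b p q => b.cost + 1 + max p.maxCost q.maxCost
  | loop _ _ => 0

lemma achieves_of_exec {p : Prog} {s : Store} {b : ℕ} {Q : Store → Prop} (hp : p.loopFree = true)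
    (hb : p.maxCost ≤ b) (hQ : Q (p.exec s)) : p.Achieves s b Q := by
  have key : ∀ s, p.Achieves s p.maxCost (· = p.exec s) := by
    clear hQ hb
    induction p with
    | skip => exact fun s => ⟨_, _, .skip s, le_rfl, rfl⟩
    | assignNat a i e => exact fun s => ⟨_, _, .assignNat a i e s, le_rfl, rfl⟩
    | assignReal a i e => exact fun s => ⟨_, _, .assignReal a i e s, le_rfl, rfl⟩
    | seq p q ihp ihq =>
      simp only [loopFree, Bool.and_eq_true] at hp
      intro s
      refine (ihp hp.1 s).seq ?_
      rintro _ - rfl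
      exact ihq hp.2 _
    | ite t p q ihp ihq =>
      simp only [loopFree, Bool.and_eq_true] at hp
      intro s
      refine .ite (fun h => ?_) fun h => ?_
      · refine (ihp hp.1 s).mono (le_max_left _ _) fun s' _ h' => ?_
        simpa [exec, h] using h'
      · refine (ihq hp.2 s).mono (le_max_right _ _) fun s' _ h' => ?_
        simpa [exec, h] using h'
    | loop => simp [loopFree] at hp
  exact (key s).mono hb fun s' _ h => h ▸ hQ

/-- `for i := 0, …, bound - 1`: the loop variable is cell `0` of the natural-number array `i`. -/
def forLoop (i : ℕ) (bound : NatExpr) (body : Prog) : Prog :=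
  .seq (.assignNat i (.lit 0) (.lit 0))
    (.loop (.natLe (.add (.get i (.lit 0)) (.lit 1)) bound)
      (.seq body (.assignNat i (.lit 0) (.add (.get i (.lit 0)) (.lit 1)))))

/-- The invariant rule for counting loops. The body may rely on all arrays that the loop does not
write being as they were before the loop. -/
lemma achieves_forLoop {i : ℕ} {bound : NatExpr} {body : Prog} {s : Store} {m b : ℕ}
    (Inv : ℕ → Store → Prop) (hi : body.writesNat i = false)
    (hm : ∀ s', (forLoop i bound body).Agree s s' → bound.eval s' = m)
    (h0 : Inv 0 (s.setNat i 0 0))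
    (step : ∀ j < m, ∀ s', (forLoop i bound body).Agree s s' → Inv j s' → s'.nat i 0 = j →
      body.Achieves s' b fun s'' => Inv (j + 1) (s''.setNat i 0 (j + 1))) :
    (forLoop i bound body).Achieves s (m * (b + bound.cost + 12) + bound.cost + 9) (Inv m) := by
  set F := forLoop i bound body with hF
  set l : Prog := .loop (.natLe (.add (.get i (.lit 0)) (.lit 1)) bound)
      (.seq body (.assignNat i (.lit 0) (.add (.get i (.lit 0)) (.lit 1)))) with hl
  have hsub : ∀ {s s' : Store}, body.Agree s s' → F.Agree s s' := fun h =>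
    h.of_subset (by simp +contextual [hF, forLoop, writesNat])
      (by simp +contextual [hF, forLoop, writesReal])
  have hset : ∀ (s : Store) v, F.Agree s (s.setNat i 0 v) := fun s v =>
    ((Runs.assignNat i (.lit 0) (.lit v) s).agree.of_subset
      (by simp +contextual [hF, forLoop, writesNat])
      (by simp [writesReal]) : F.Agree s _)
  have key : ∀ d j s', d + j = m → F.Agree s s' → Inv j s' → s'.nat i 0 = j →
      l.Achieves s' (d * (b + bound.cost + 12) + bound.cost + 6) (Inv m) := by
    intro d
    induction d with
    | zero =>
      intro j s' hj hs hinv hij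
      refine ⟨s', _, .loopDone ?_, ?_, by obtain rfl : j = m := by omega
                                          exact hinv⟩
      · simp [Test.Holds, NatExpr.eval, hm s' hs, hij]; omega
      · simp [Test.cost, NatExpr.cost]; omega
    | succ d ih =>
      intro j s' hj hs hinv hij
      obtain ⟨s'', c, hr, hc, hinv'⟩ := step j (by omega) s' hs hinv hij
      have hij' : s''.nat i 0 = j := by rw [hr.agree.nat i hi, hij]
      have hinc := Runs.assignNat i (.lit 0) (.add (.get i (.lit 0)) (.lit 1)) s''
      simp only [NatExpr.eval, NatExpr.cost, hij'] at hinc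
      obtain ⟨s₃, c₃, hr₃, hc₃, hq₃⟩ := ih (j + 1) (s''.setNat i 0 (j + 1)) (by omega)
        ((hs.trans (hsub hr.agree)).trans (hset _ _)) hinv' (by simp [Store.setNat])
      refine ⟨s₃, _, .loopStep ?_ (hr.seq hinc) hr₃, ?_, hq₃⟩
      · simp [Test.Holds, NatExpr.eval, hm s' hs, hij]; omega
      · simp only [Test.cost, NatExpr.cost]
        rw [Nat.succ_mul]
        omega
  obtain ⟨s', c, hr, hc, hq⟩ := key m 0 (s.setNat i 0 0) rfl (hset s 0) h0 (by simp [Store.setNat])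
  refine ⟨s', _, (Runs.assignNat i (.lit 0) (.lit 0) s).seq hr, ?_, hq⟩
  simp only [NatExpr.cost]
  omega

/-- The cost of a counting loop, if the cost of the body is of degree `d`. -/
lemma loop_cost_le {m b e S K d : ℕ} (hm : m ≤ S) (hS : 1 ≤ S) (hb : b ≤ K * S ^ d) :
    m * (b + e + 12) + e + 9 ≤ (K + 2 * e + 21) * S ^ (d + 1) := by
  have h1 : 1 ≤ S ^ d := Nat.one_le_pow _ _ hS
  calc m * (b + e + 12) + e + 9 ≤ S * (K * S ^ d + (e + 12) * S ^ d) + (e + 9) * (S * S ^ d) := by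
        have h2 : b + e + 12 ≤ K * S ^ d + (e + 12) * S ^ d := by nlinarith
        have h3 : 1 ≤ S * S ^ d := Nat.mul_pos hS h1
        have h4 := Nat.mul_le_mul hm h2
        nlinarith
    _ = (K + 2 * e + 21) * S ^ (d + 1) := by ring

end Prog

/-! ### The planning program -/

namespace Chain

variable {M : Chain}

/-- Among the nodes of `D`, the node at address `sel` is outside of `C` and has the largest ratio
`best`; if there is no such node, then `sel` is the first address after those of all nodes, and
`best` is `-1`, which is smaller than all ratios. -/
def Chosen (M : Chain) (C D : ℕ → ℕ → Prop) (sel : ℕ) (best : ℝ) : Prop :=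
  (∀ k g, D k g → ¬ C k g → M.ratio C k g ≤ best) ∧
  ((sel = M.horizon * M.size ∧ best = -1) ∨
    ∃ k < M.horizon, ∃ g < M.size, ¬ C k g ∧ sel = k * M.size + g ∧ best = M.ratio C k g)

lemma Chosen.mono {C D D' : ℕ → ℕ → Prop} {sel : ℕ} {best : ℝ} (h : M.Chosen C D sel best)
    (hD : ∀ k g, D' k g → D k g ∨ C k g ∨ M.ratio C k g ≤ best) : M.Chosen C D' sel best := by
  refine ⟨fun k g hkg hC => ?_, h.2⟩
  rcases hD k g hkg with h' | h' | h'
  · exact h.1 k g h' hC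
  · exact absurd h' hC
  · exact h'

lemma Chosen.update {C D D' : ℕ → ℕ → Prop} {sel : ℕ} {best : ℝ} (h : M.Chosen C D sel best)
    {k g : ℕ} (hk : k < M.horizon) (hg : g < M.size) (hC : ¬ C k g) (hlt : best ≤ M.ratio C k g)
    (hD : ∀ k' g', D' k' g' → D k' g' ∨ (k' = k ∧ g' = g)) :
    M.Chosen C D' (k * M.size + g) (M.ratio C k g) := by
  refine ⟨fun k' g' hkg hC' => ?_, .inr ⟨k, hk, g, hg, hC, rfl, rfl⟩⟩
  rcases hD k' g' hkg with h' | ⟨rfl, rfl⟩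
  · exact (h.1 k' g' h' hC').trans hlt
  · exact le_rfl

/-- The nodes that a sweep from the last row to the first has treated, when `kk` rows and `j`
nodes of the next row are done. -/
def Done (M : Chain) (kk j k g : ℕ) : Prop :=
  k ≤ M.horizon ∧ g < M.size ∧ (M.horizon ≤ k + kk ∨ (k + kk + 1 = M.horizon ∧ g < j))

end Chain

namespace Program

/-! The natural-number arrays `0`, `1`, `2` hold the input and `3`, `4`, `5` the position and the
decision. Array `6` holds the multiples of the number of states, and array `7` the order in which
the nodes enter the stopping rule; the node `(k, g)` has the address `k * size + g`. The other
natural-number arrays are scalars: `8` the stage, `9`, `10`, `11`, `16`, `17` loop variables,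
`12`, `13`, `14` addresses, `15` the address of the best node, `18` the best stage.

The real arrays `0`, `1` hold the input, `3` and `4` the expected reward and the expected number
of plays from each node, and `10` the indices of the arms. The other real arrays are scalars: `2`
the horizon, `5`, `6` expectations at the current node, `7` the best ratio, `8` the score, `9` the
best score, `11` the best index. -/

/-- The scalar that is kept in a natural-number array. -/
abbrev var (a : ℕ) : NatExpr := .get a (.lit 0)

/-- The scalar that is kept in a real array. -/
abbrev rvar (a : ℕ) : RealExpr := .get a (.lit 0)

/-- The address of the row `e` of a table with one column for each state. -/
abbrev row (e : NatExpr) : NatExpr := .get 6 e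

/-- The horizon. -/
abbrev horizonE : NatExpr := .get 0 (.lit 0)

/-- The number of arms. -/
abbrev armsE : NatExpr := .get 0 (.lit 1)

/-- The number of states. -/
abbrev statesE : NatExpr := .get 0 (.lit 2)

/-- Tabulate the multiples of the number of states. -/
def rowsProg : Prog :=
  .forLoop 8 (.add horizonE statesE)
    (.assignNat 6 (.add (var 8) (.lit 1)) (.add (row (var 8)) statesE))

/-- Convert the horizon to a real number. -/
def realHorizonProg : Prog :=
  .forLoop 8 horizonE (.assignReal 2 (.lit 0) (.add (rvar 2) (.lit 1)))

/-- Compute the addresses of the current node, of the row of its transition probabilities, and of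
the row of its successors, and start the expectations at the current node. -/
def nodeStart : Prog :=
  .seq (.assignNat 12 (.lit 0) (.add (row (.sub (.sub horizonE (var 9)) (.lit 1))) (var 10)))
  (.seq (.assignNat 13 (.lit 0) (row (var 10)))
  (.seq (.assignNat 14 (.lit 0) (row (.sub horizonE (var 9))))
  (.seq (.assignReal 5 (.lit 0) (.get 0 (var 10)))
  (.assignReal 6 (.lit 0) (.lit 1)))))

/-- Add the contribution of one successor to the expectations at the current node. -/
def successorStep : Prog :=
  .seq (.assignReal 5 (.lit 0) (.add (rvar 5) (.mul (.get 1 (.add (var 13) (var 11)))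
    (.get 3 (.add (var 14) (var 11))))))
  (.assignReal 6 (.lit 0) (.add (rvar 6) (.mul (.get 1 (.add (var 13) (var 11)))
    (.get 4 (.add (var 14) (var 11))))))

/-- Store the results at the current node; if it is not in the stopping rule, compare its ratio
with the best one. -/
def nodeEnd : Prog :=
  .ite (.natLe (.lit 1) (.get 7 (var 12)))
    (.seq (.assignReal 3 (var 12) (rvar 5)) (.assignReal 4 (var 12) (rvar 6)))
    (.seq (.assignReal 3 (var 12) (.lit 0))
    (.seq (.assignReal 4 (var 12) (.lit 0))
    (.ite (.realLe (.div (rvar 5) (rvar 6)) (rvar 7)) .skip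
      (.seq (.assignReal 7 (.lit 0) (.div (rvar 5) (rvar 6)))
      (.assignNat 15 (.lit 0) (var 12))))))

/-- Treat one node. -/
def nodeProg : Prog := .seq nodeStart (.seq (.forLoop 11 statesE successorStep) nodeEnd)

/-- Evaluate the stopping rule at all nodes, and find the best node to add. -/
def sweepProg : Prog :=
  .seq (.seq (.assignNat 15 (.lit 0) (row horizonE)) (.assignReal 7 (.lit 0) (.lit (-1))))
    (.forLoop 9 horizonE (.forLoop 10 statesE nodeProg))

/-- Subtract the smaller of two products from the score. -/
def lossStep : Prog :=
  .ite (.realLe (.mul (.get 3 (.get 2 (var 16))) (.get 4 (.get 2 (var 17))))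
      (.mul (.get 3 (.get 2 (var 17))) (.get 4 (.get 2 (var 16)))))
    (.assignReal 8 (.lit 0) (.sub (rvar 8)
      (.mul (.get 3 (.get 2 (var 16))) (.get 4 (.get 2 (var 17))))))
    (.assignReal 8 (.lit 0) (.sub (rvar 8)
      (.mul (.get 3 (.get 2 (var 17))) (.get 4 (.get 2 (var 16))))))

/-- Compute the score of the stopping rule. -/
def scoreProg : Prog :=
  .seq (.assignReal 8 (.lit 0) (.lit 0))
    (.forLoop 16 armsE
      (.seq (.assignReal 8 (.lit 0) (.add (rvar 8)
          (.mul (.add (.mul (.lit 2) (rvar 2)) (.get 4 (.get 2 (var 16))))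
            (.get 3 (.get 2 (var 16))))))
        (.forLoop 17 armsE lossStep)))

/-- Keep the stage and the indices if the score is better than all earlier ones. -/
def keepProg : Prog :=
  .ite (.realLe (rvar 8) (rvar 9)) .skip
    (.seq (.seq (.assignReal 9 (.lit 0) (rvar 8)) (.assignNat 18 (.lit 0) (var 8)))
      (.forLoop 16 armsE (.assignReal 10 (var 16)
        (.div (.get 3 (.get 2 (var 16))) (.get 4 (.get 2 (var 16)))))))

/-- Add the best node to the stopping rule. The test makes sure that the recorded order of entry
never changes, even if no node is left and the address after the last node is chosen repeatedly. -/
def addProg : Prog :=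
  .ite (.natLe (.lit 1) (.get 7 (var 15))) .skip
    (.assignNat 7 (var 15) (.add (var 8) (.lit 1)))

/-- The planning algorithm. It has one stage more than there are nodes, since the score of the rule
that contains all nodes has to be computed as well. -/
def plan : Prog :=
  .seq rowsProg (.seq realHorizonProg
    (.forLoop 8 (.add (row horizonE) (.lit 1))
      (.seq sweepProg (.seq scoreProg (.seq keepProg addProg)))))

variable {I : Instance.{u}}

/-- The memory holds the input, the multiples of the number of states, and the horizon as a real
number. -/
structure Ready (I : Instance.{u}) (s : Store) : Prop where
  dims : s.nat 0 = I.input.nat 0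
  roots : s.nat 2 = I.input.nat 2
  reward : s.real 0 = I.input.real 0
  trans : s.real 1 = I.input.real 1
  rows : ∀ j ≤ I.horizon + I.totalStates, s.nat 6 j = j * I.totalStates
  horizon : s.real 2 0 = I.horizon

/-- The program does not write the arrays on which `Ready` depends. -/
def KeepsReady (p : Prog) : Bool :=
  !(p.writesNat 0 || p.writesNat 2 || p.writesNat 6 || p.writesReal 0 || p.writesReal 1 ||
    p.writesReal 2)

lemma Ready.of_agree {s s' : Store} {p : Prog} (h : Ready I s) (ha : p.Agree s s')
    (hp : KeepsReady p = true) : Ready I s' := by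
  simp only [KeepsReady, Bool.not_eq_true', Bool.or_eq_false_iff] at hp
  obtain ⟨⟨⟨⟨⟨h0, h2⟩, h6⟩, r0⟩, r1⟩, r2⟩ := hp
  exact ⟨(ha.nat 0 h0).trans h.dims, (ha.nat 2 h2).trans h.roots, (ha.real 0 r0).trans h.reward,
    (ha.real 1 r1).trans h.trans, fun j hj => by rw [ha.nat 6 h6, h.rows j hj],
    by rw [ha.real 2 r2, h.horizon]⟩

lemma Ready.horizon_eq {s : Store} (h : Ready I s) : s.nat 0 0 = I.horizon := by
  rw [h.dims]; rfl

lemma Ready.arms_eq {s : Store} (h : Ready I s) : s.nat 0 1 = I.numArms := by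
  rw [h.dims]; rfl

lemma Ready.states_eq {s : Store} (h : Ready I s) : s.nat 0 2 = I.totalStates := by
  rw [h.dims]; rfl

/-- A bound for the number of iterations of all inner loops. -/
def scale (I : Instance.{u}) : ℕ := I.horizon + I.totalStates + 1

lemma one_le_scale : 1 ≤ scale I := Nat.le_add_left _ _

lemma numArms_le_totalStates : I.numArms ≤ I.totalStates := by
  have : ∑ _i : Fin I.numArms, 1 ≤ ∑ i, (I.arm i).card :=
    Finset.sum_le_sum fun i _ => Fin.pos (I.arm i).root
  simpa [Instance.totalStates] using this

lemma rowsProg_spec {s : Store} (hs : ∀ j, s.nat 0 j = I.input.nat 0 j) (h0 : s.nat 6 0 = 0) :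
    rowsProg.Achieves s (100 * scale I ^ 1) fun s' =>
      ∀ j ≤ I.horizon + I.totalStates, s'.nat 6 j = j * I.totalStates := by
  have hd : s.nat 0 0 = I.horizon ∧ s.nat 0 2 = I.totalStates := by
    rw [hs, hs]; exact ⟨rfl, rfl⟩
  refine (Prog.achieves_forLoop (m := I.horizon + I.totalStates) (b := 40 * scale I ^ 0)
    (fun m s' => ∀ j ≤ m, s'.nat 6 j = j * I.totalStates) rfl ?_ ?_ ?_).mono ?_ ?_
  · intro s' ha
    simp [NatExpr.eval, ha.nat 0 rfl, hd]
  · intro j hj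
    obtain rfl : j = 0 := by omega
    simp [Store.setNat, h0]
  · intro m hm s' ha hinv hi
    refine Prog.achieves_of_exec rfl (by rw [pow_zero]; decide) ?_
    intro j hj
    have hN : s'.nat 0 2 = I.totalStates := by rw [ha.nat 0 rfl, hd.2]
    simp only [Prog.exec, NatExpr.eval, Store.setNat, hi, hN]
    by_cases hjm : j = m + 1
    · simp [hjm, hinv m le_rfl, Nat.succ_mul]
    · simp [hjm, hinv j (by omega)]
  · exact (Prog.loop_cost_le (d := 0) (by unfold scale; omega) one_le_scale le_rfl).trans
      (Nat.mul_le_mul_right _ (by decide))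
  · exact fun s' _ h => h

lemma realHorizonProg_spec {s : Store} (hs : ∀ j, s.nat 0 j = I.input.nat 0 j)
    (h0 : s.real 2 0 = 0) :
    realHorizonProg.Achieves s (100 * scale I ^ 1) fun s' => s'.real 2 0 = I.horizon := by
  refine (Prog.achieves_forLoop (m := I.horizon) (b := 40 * scale I ^ 0)
    (fun m s' => s'.real 2 0 = m) rfl ?_ ?_ ?_).mono ?_ ?_
  · intro s' ha
    simp only [NatExpr.eval, ha.nat 0 rfl, hs]
    rfl
  · simp [Store.setNat, h0]
  · intro m hm s' ha hinv hi
    refine Prog.achieves_of_exec rfl (by rw [pow_zero]; decide) ?_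
    simp [Prog.exec, NatExpr.eval, RealExpr.eval, Store.setNat, Store.setReal, hinv]
  · exact (Prog.loop_cost_le (d := 0) (by unfold scale; omega) one_le_scale le_rfl).trans
      (Nat.mul_le_mul_right _ (by decide))
  · exact fun s' _ h => h

/-- The state of a sweep after `kk` rows and `j` nodes of the next row. -/
structure SweepInv (I : Instance.{u}) (C : ℕ → ℕ → Prop) (kk j : ℕ) (s : Store) : Prop where
  reward : ∀ k g, I.chain.Done kk j k g →
    s.real 3 (k * I.totalStates + g) = I.chain.total C I.chain.reward k g
  plays : ∀ k g, I.chain.Done kk j k g →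
    s.real 4 (k * I.totalStates + g) = I.chain.total C (fun _ => 1) k g
  chosen : I.chain.Chosen C (fun k g => k < I.horizon ∧ I.chain.Done kk j k g)
    (s.nat 15 0) (s.real 7 0)

lemma SweepInv.mono {C : ℕ → ℕ → Prop} {kk j kk' j' : ℕ} {s s' : Store} (h : SweepInv I C kk j s)
    (hD : ∀ k g, I.chain.Done kk' j' k g → I.chain.Done kk j k g) (h3 : s'.real 3 = s.real 3)
    (h4 : s'.real 4 = s.real 4) (h7 : s'.real 7 = s.real 7) (h15 : s'.nat 15 = s.nat 15) :
    SweepInv I C kk' j' s' := by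
  refine ⟨fun k g hd => by rw [h3, h.reward k g (hD k g hd)],
    fun k g hd => by rw [h4, h.plays k g (hD k g hd)], ?_⟩
  rw [h7, h15]
  exact h.chosen.mono fun k g hd => .inl ⟨hd.1, hD k g hd.2⟩

lemma SweepInv.setNat {C : ℕ → ℕ → Prop} {kk j kk' j' : ℕ} {s : Store} (h : SweepInv I C kk j s)
    (hD : ∀ k g, I.chain.Done kk' j' k g → I.chain.Done kk j k g) {a i v : ℕ} (ha : 15 ≠ a) :
    SweepInv I C kk' j' (s.setNat a i v) :=
  h.mono hD rfl rfl rfl (funext fun j => by simp [Store.setNat, ha])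

lemma address_injective {N k g k' g' : ℕ} (hg : g < N) (hg' : g' < N)
    (h : k * N + g = k' * N + g') : k = k' ∧ g = g' := by
  have h1 := congrArg (· / N) h
  have h2 := congrArg (· % N) h
  have hN : 0 < N := by omega
  simp only [mul_comm _ N,
    Nat.mul_add_div hN, Nat.div_eq_of_lt hg, Nat.div_eq_of_lt hg', Nat.mul_add_mod,
    Nat.mod_eq_of_lt hg, Nat.mod_eq_of_lt hg', add_zero] at h1 h2
  exact ⟨h1, h2⟩

/-- Treating node `(k, g)` of a sweep. -/
lemma nodeProg_spec {C : ℕ → ℕ → Prop} {s : Store} {kk g k : ℕ} (hs : Ready I s)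
    (hC : ∀ k < I.horizon, ∀ g < I.totalStates,
      (C k g ↔ 1 ≤ s.nat 7 (k * I.totalStates + g)))
    (hk : k + kk + 1 = I.horizon) (hg : g < I.totalStates) (h9 : s.nat 9 0 = kk)
    (h10 : s.nat 10 0 = g) (hinv : SweepInv I C kk g s) :
    nodeProg.Achieves s (300 * scale I ^ 1) (SweepInv I C kk (g + 1)) := by
  have hS : 1 ≤ scale I ^ 1 := Nat.one_le_pow _ _ one_le_scale
  have hkT : k < I.horizon := by omega
  refine Prog.Achieves.mono (b := 80 + (150 * scale I ^ 1 + 70)) (Q := SweepInv I C kk (g + 1)) ?_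
    (by omega) fun _ _ h => h
  refine Prog.Achieves.seq (Q := fun s' => s'.nat 12 0 = k * I.totalStates + g ∧
    s'.nat 13 0 = g * I.totalStates ∧ s'.nat 14 0 = (k + 1) * I.totalStates ∧
    s'.real 5 0 = I.chain.reward g ∧ s'.real 6 0 = 1) ?_ ?_
  · refine Prog.achieves_of_exec rfl (by decide) ?_
    have e2 : I.horizon - kk = k + 1 := by omega
    simp only [nodeStart, Prog.exec, NatExpr.eval, RealExpr.eval, Store.setNat, Store.setReal]
    simp [h9, h10, hs.horizon_eq, e2, hs.rows k (by omega), hs.rows (k + 1) (by omega),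
      hs.rows g (by omega), hs.reward]
    rfl
  rintro s₁ ha₁ ⟨h12, h13, h14, h5, h6⟩
  have hs₁ : Ready I s₁ := hs.of_agree ha₁ rfl
  have hinv₁ : SweepInv I C kk g s₁ := hinv.mono (fun _ _ h => h) (ha₁.real 3 rfl) (ha₁.real 4 rfl)
    (ha₁.real 7 rfl) (ha₁.nat 15 rfl)
  refine Prog.Achieves.seq (Q := fun s' => s'.real 5 0 = I.chain.cont C I.chain.reward k g ∧
    s'.real 6 0 = I.chain.cont C (fun _ => 1) k g) ?_ ?_
  · refine (Prog.achieves_forLoop (m := I.totalStates) (b := 60 * scale I ^ 0)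
      (fun m s' =>
        s'.real 5 0 = I.chain.reward g + ∑ h ∈ Finset.range m, I.chain.trans g h *
          I.chain.total C I.chain.reward (k + 1) h ∧
        s'.real 6 0 = 1 + ∑ h ∈ Finset.range m, I.chain.trans g h *
          I.chain.total C (fun _ => 1) (k + 1) h) rfl ?_ ?_ ?_).mono ?_ ?_
    · intro s' ha
      simp only [NatExpr.eval, ha.nat 0 rfl, hs₁.states_eq]
    · simp [Store.setNat, h5, h6]
    · intro m hm s' ha hsum hi
      refine Prog.achieves_of_exec rfl (by rw [pow_zero]; decide) ?_
      have hd : I.chain.Done kk g (k + 1) m := ⟨hkT, hm, .inl (by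
        change I.horizon ≤ _
        omega)⟩
      have e3 := hinv₁.reward _ _ hd
      have e4 := hinv₁.plays _ _ hd
      have e1 : s₁.real 1 (g * I.totalStates + m) = I.chain.trans g m := by rw [hs₁.trans]; rfl
      simp only [successorStep, Prog.exec, NatExpr.eval, RealExpr.eval, Store.setNat,
        Store.setReal, hi, ha.nat 13 rfl, ha.nat 14 rfl, ha.real 1 rfl, ha.real 3 rfl,
        ha.real 4 rfl, h13, h14]
      simp [hsum, Finset.sum_range_succ, e1, e3, e4, add_assoc]
    · exact (Prog.loop_cost_le (d := 0) (by unfold scale; omega) one_le_scale le_rfl).trans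
        (Nat.mul_le_mul_right _ (by decide))
    · exact fun s' _ h => h
  rintro s₂ ha₂ ⟨h5', h6'⟩
  have hinv₂ : SweepInv I C kk g s₂ := hinv₁.mono (fun _ _ h => h) (ha₂.real 3 rfl)
    (ha₂.real 4 rfl) (ha₂.real 7 rfl) (ha₂.nat 15 rfl)
  have h12' : s₂.nat 12 0 = k * I.totalStates + g := by rw [ha₂.nat 12 rfl, h12]
  have h7 : s₂.nat 7 = s.nat 7 := by rw [ha₂.nat 7 rfl, ha₁.nat 7 rfl]
  refine Prog.achieves_of_exec rfl (by decide) ?_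
  have hdone : ∀ k' g', I.chain.Done kk (g + 1) k' g' →
      I.chain.Done kk g k' g' ∨ (k' = k ∧ g' = g) := by
    rintro k' g' ⟨h1, h2, h3⟩
    have hT : I.chain.horizon = I.horizon := rfl
    by_cases hkg : k' = k ∧ g' = g
    · exact .inr hkg
    · exact .inl ⟨h1, h2, by omega⟩
  have htable : ∀ (f : ℕ → ℝ) (w : ℕ → ℝ) (v : ℝ), v = I.chain.total C w k g →
      (∀ k' g', I.chain.Done kk g k' g' →
        f (k' * I.totalStates + g') = I.chain.total C w k' g') →
      ∀ k' g', I.chain.Done kk (g + 1) k' g' →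
        (if k' * I.totalStates + g' = k * I.totalStates + g then v
          else f (k' * I.totalStates + g')) = I.chain.total C w k' g' := by
    intro f w v hv hf k' g' hd
    split_ifs with h
    · obtain ⟨rfl, rfl⟩ := address_injective hd.2.1 hg h
      exact hv
    · rcases hdone k' g' hd with hd' | ⟨rfl, rfl⟩
      · exact hf k' g' hd'
      · exact absurd rfl h
  by_cases hm : C k g
  · have hm' : 1 ≤ s₂.nat 7 (k * I.totalStates + g) := by rw [h7]; exact (hC k hkT g hg).1 hm
    simp only [nodeEnd, Prog.exec, Test.Holds, NatExpr.eval, h12', hm', if_true]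
    refine ⟨?_, ?_, ?_⟩
    · simpa [RealExpr.eval, NatExpr.eval, Store.setReal, h12', h5'] using
        htable _ _ _ (Chain.total_of_mem hkT hm).symm hinv₂.reward
    · simpa [RealExpr.eval, NatExpr.eval, Store.setReal, h12', h6'] using
        htable _ _ _ (Chain.total_of_mem hkT hm).symm hinv₂.plays
    · refine Chain.Chosen.mono (D := fun k' g' => k' < I.horizon ∧ I.chain.Done kk g k' g') ?_ ?_
      · simpa [Store.setReal] using hinv₂.chosen
      · rintro k' g' ⟨h1, h2⟩
        rcases hdone k' g' h2 with hd' | ⟨rfl, rfl⟩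
        · exact .inl ⟨h1, hd'⟩
        · exact .inr (.inl hm)
  · have hm' : ¬ 1 ≤ s₂.nat 7 (k * I.totalStates + g) := by
      rw [h7]; exact mt (hC k hkT g hg).2 hm
    have hr : s₂.real 5 0 / s₂.real 6 0 = I.chain.ratio C k g := by rw [h5', h6']; rfl
    have hR := htable _ _ _ (Chain.total_of_not_mem (M := I.chain) hm).symm hinv₂.reward
    have hP := htable _ _ _ (Chain.total_of_not_mem (M := I.chain) hm).symm hinv₂.plays
    simp only [nodeEnd, Prog.exec, Test.Holds, NatExpr.eval, h12', hm', if_false]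
    by_cases hb : I.chain.ratio C k g ≤ s₂.real 7 0
    · rw [if_pos (by simpa [RealExpr.eval, NatExpr.eval, Store.setReal, hr] using hb)]
      refine ⟨?_, ?_, ?_⟩
      · simpa [RealExpr.eval, NatExpr.eval, Store.setReal, h12'] using hR
      · simpa [RealExpr.eval, NatExpr.eval, Store.setReal, h12'] using hP
      · refine Chain.Chosen.mono (D := fun k' g' => k' < I.horizon ∧ I.chain.Done kk g k' g') ?_ ?_
        · simpa [Store.setReal] using hinv₂.chosen
        · rintro k' g' ⟨h1, h2⟩
          rcases hdone k' g' h2 with hd' | ⟨rfl, rfl⟩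
          · exact .inl ⟨h1, hd'⟩
          · exact .inr (.inr (by simpa [Store.setReal] using hb))
    · rw [if_neg (by simpa [RealExpr.eval, NatExpr.eval, Store.setReal, hr] using hb)]
      refine ⟨?_, ?_, ?_⟩
      · simpa [RealExpr.eval, NatExpr.eval, Store.setReal, Store.setNat, h12'] using hR
      · simpa [RealExpr.eval, NatExpr.eval, Store.setReal, Store.setNat, h12'] using hP
      · have := hinv₂.chosen.update hkT hg hm (not_le.1 hb).le
          (D' := fun k' g' => k' < I.horizon ∧ I.chain.Done kk (g + 1) k' g') (by
            rintro k' g' ⟨h1, h2⟩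
            exact (hdone k' g' h2).imp_left fun h => ⟨h1, h⟩)
        change I.chain.Chosen C _ (k * I.totalStates + g) _ at this
        simpa [RealExpr.eval, NatExpr.eval, Store.setReal, Store.setNat, h12', hr] using this

/-- A sweep evaluates the stopping rule at all nodes and finds the best node to add. -/
lemma sweepProg_spec {C : ℕ → ℕ → Prop} {s : Store} (hs : Ready I s)
    (hC : ∀ k < I.horizon, ∀ g < I.totalStates,
      (C k g ↔ 1 ≤ s.nat 7 (k * I.totalStates + g)))
    (h3 : ∀ g < I.totalStates, s.real 3 (I.horizon * I.totalStates + g) = 0)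
    (h4 : ∀ g < I.totalStates, s.real 4 (I.horizon * I.totalStates + g) = 0) :
    sweepProg.Achieves s (500 * scale I ^ 3) (SweepInv I C I.horizon 0) := by
  have hS : 1 ≤ scale I ^ 3 := Nat.one_le_pow _ _ one_le_scale
  refine Prog.Achieves.mono (b := 20 + 400 * scale I ^ 3) (Q := SweepInv I C I.horizon 0) ?_
    (by omega) fun _ _ h => h
  refine Prog.Achieves.seq (Q := SweepInv I C 0 0) ?_ fun s₁ ha₁ hinv₁ => ?_
  · refine Prog.achieves_of_exec rfl (by decide) ?_
    have hrow : ∀ k g, I.chain.Done 0 0 k g → k = I.horizon ∧ g < I.totalStates := by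
      rintro k g ⟨h1, h2, h3⟩
      have hT : I.chain.horizon = I.horizon := rfl
      exact ⟨by omega, h2⟩
    refine ⟨fun k g hd => ?_, fun k g hd => ?_, ?_, .inl ?_⟩
    · obtain ⟨rfl, hg⟩ := hrow k g hd
      rw [Chain.total_horizon (M := I.chain) (show I.chain.horizon ≤ I.horizon from le_rfl)]
      simpa [Prog.exec, Store.setReal, Store.setNat] using h3 g hg
    · obtain ⟨rfl, hg⟩ := hrow k g hd
      rw [Chain.total_horizon (M := I.chain) (show I.chain.horizon ≤ I.horizon from le_rfl)]
      simpa [Prog.exec, Store.setReal, Store.setNat] using h4 g hg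
    · rintro k g ⟨h1, h2⟩
      exact absurd (hrow k g h2).1 h1.ne
    · simp [Prog.exec, Store.setReal, Store.setNat, NatExpr.eval, RealExpr.eval, hs.horizon_eq,
        hs.rows I.horizon (by omega)]
      rfl
  have hs₁ : Ready I s₁ := hs.of_agree ha₁ rfl
  have h7₁ : s₁.nat 7 = s.nat 7 := ha₁.nat 7 rfl
  refine (Prog.achieves_forLoop (m := I.horizon) (b := 350 * scale I ^ 2)
    (fun kk => SweepInv I C kk 0) rfl ?_ ?_ ?_).mono ?_ fun _ _ h => h
  · intro s' ha
    simp only [NatExpr.eval, ha.nat 0 rfl, hs₁.horizon_eq]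
  · exact hinv₁.setNat (fun _ _ h => h) (by decide)
  · intro kk hkk s' ha hinv hi
    have hs' : Ready I s' := hs₁.of_agree ha rfl
    refine (Prog.achieves_forLoop (m := I.totalStates) (b := 300 * scale I ^ 1)
      (fun g => SweepInv I C kk g) rfl ?_ ?_ ?_).mono ?_ ?_
    · intro s'' ha'
      simp only [NatExpr.eval, ha'.nat 0 rfl, hs'.states_eq]
    · exact hinv.setNat (fun _ _ h => h) (by decide)
    · intro g hg s'' ha' hinv' hi'
      refine (nodeProg_spec (k := I.horizon - kk - 1) (hs'.of_agree ha' rfl) ?_ (by omega) hg ?_ hi'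
        hinv').mono le_rfl fun s₃ _ h => h.setNat (fun _ _ h => h) (by decide)
      · intro k hk g hg
        rw [hC k hk g hg, ha'.nat 7 rfl, ha.nat 7 rfl, h7₁]
      · rw [ha'.nat 9 rfl, hi]
    · exact (Prog.loop_cost_le (d := 1) (by unfold scale; omega) one_le_scale le_rfl).trans
        (Nat.mul_le_mul_right _ (by decide))
    · intro s₃ _ h
      refine h.setNat (fun k g hd => ?_) (by decide)
      obtain ⟨h1, h2, h3⟩ := hd
      refine ⟨h1, h2, ?_⟩
      change I.horizon ≤ _ ∨ (_ = I.horizon ∧ g < I.totalStates)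
      change I.horizon ≤ _ ∨ (_ = I.horizon ∧ _) at h3
      change g < I.totalStates at h2
      omega
  · exact (Prog.loop_cost_le (d := 2) (by unfold scale; omega) one_le_scale le_rfl).trans
      (Nat.mul_le_mul_right _ (by decide))

end Program

namespace Chain

variable {M : Chain}

lemma GreedyStep.congr {o o' : ℕ → ℕ} {c : ℕ} (h : M.GreedyStep o c)
    (h1 : M.stage o' c = M.stage o c) (h2 : M.stage o' (c + 1) = M.stage o (c + 1)) :
    M.GreedyStep o' c := by
  unfold GreedyStep
  rw [h1, h2]
  exact h

/-- Recording a new node under the number `c + 1` does not affect the stages up to `c`. -/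
lemma stage_record {o : ℕ → ℕ} {c sel c' : ℕ} (hc' : c' ≤ c) :
    M.stage (fun p => if p = sel ∧ o sel = 0 then c + 1 else o p) c' = M.stage o c' := by
  funext k g
  simp only [stage, eq_iff_iff]
  by_cases h : k * M.size + g = sel ∧ o sel = 0
  · have h0 : o (k * M.size + g) = 0 := by rw [h.1, h.2]
    rw [if_pos h, h0]
    omega
  · rw [if_neg h]

/-- Recording the chosen node is a greedy step. -/
lemma Chosen.greedyStep (hM : M.Valid) {o : ℕ → ℕ} {c sel : ℕ} {best : ℝ} {D : ℕ → ℕ → Prop}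
    (ho : ∀ p, o p ≤ c) (h : M.Chosen (M.stage o c) D sel best)
    (hD : ∀ k < M.horizon, ∀ g < M.size, D k g) :
    M.GreedyStep (fun p => if p = sel ∧ o sel = 0 then c + 1 else o p) c := by
  unfold GreedyStep
  rw [stage_record le_rfl]
  rcases h with ⟨hmax, ⟨-, rfl⟩ | ⟨k₀, hk₀, g₀, hg₀, hn, rfl, rfl⟩⟩
  · refine .inl fun k hk g hg => ?_
    by_contra hC
    linarith [hmax k g (hD k hk g hg) hC, ratio_nonneg hM (M.stage o c) k hg]
  · refine .inr ⟨k₀, hk₀, g₀, hg₀, hn, fun k hk g hg => ?_, fun k hk g hg hC =>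
      hmax k g (hD k hk g hg) hC⟩
    have h0 : o (k₀ * M.size + g₀) = 0 := by
      simp only [stage] at hn
      have := ho (k₀ * M.size + g₀)
      omega
    simp only [stage, h0, and_true]
    have := ho (k * M.size + g)
    by_cases he : k = k₀ ∧ g = g₀
    · simp [he]
    · have hne : k * M.size + g ≠ k₀ * M.size + g₀ := fun h' =>
        he (Program.address_injective hg hg₀ h')
      rw [if_neg hne, or_iff_left he]
      omega

end Chain

namespace Program

variable {I : Instance.{u}}

lemma Ready.root_eq {s : Store} (h : Ready I s) (j : ℕ) : s.nat 2 j = I.rootCode j := by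
  rw [h.roots]; rfl

/-- The score is computed from the results at the initial states. -/
lemma scoreProg_spec {s : Store} {R τ : ℕ → ℝ} (hs : Ready I s)
    (hR : ∀ i < I.numArms, s.real 3 (I.rootCode i) = R i)
    (hτ : ∀ i < I.numArms, s.real 4 (I.rootCode i) = τ i) :
    scoreProg.Achieves s (300 * scale I ^ 2) fun s' =>
      s'.real 8 0 = score I.numArms I.horizon R τ := by
  have hS : 1 ≤ scale I ^ 2 := Nat.one_le_pow _ _ one_le_scale
  have hn : I.numArms ≤ scale I := by
    have := numArms_le_totalStates (I := I)
    unfold scale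
    omega
  refine Prog.Achieves.mono (b := 10 + 250 * scale I ^ 2) ?_ (by omega) fun _ _ h => h
  refine Prog.Achieves.seq (Q := fun s' => s'.real 8 0 = 0) ?_ fun s₁ ha₁ h8 => ?_
  · refine Prog.achieves_of_exec rfl (by decide) ?_
    simp [Prog.exec, Store.setReal, RealExpr.eval, NatExpr.eval]
  have hs₁ : Ready I s₁ := hs.of_agree ha₁ rfl
  refine (Prog.achieves_forLoop (m := I.numArms) (b := 200 * scale I ^ 1)
    (fun m s' => s'.real 8 0 = ∑ i ∈ Finset.range m,
      ((2 * (I.horizon : ℝ) + τ i) * R i -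
        ∑ j ∈ Finset.range I.numArms, min (R i * τ j) (R j * τ i))) rfl ?_ ?_ ?_).mono ?_
    fun _ _ h => h
  · intro s' ha
    simp only [NatExpr.eval, ha.nat 0 rfl, hs₁.arms_eq]
  · simpa [Store.setNat] using h8
  · intro i hi s' ha hinv hi'
    have hs' : Ready I s' := hs₁.of_agree ha rfl
    have hS1 : 1 ≤ scale I ^ 1 := Nat.one_le_pow _ _ one_le_scale
    refine Prog.Achieves.mono (b := 50 + 150 * scale I ^ 1) ?_ (by omega) fun _ _ h => h
    refine Prog.Achieves.seq (Q := fun s'' => s''.real 8 0 = (∑ i ∈ Finset.range i,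
      ((2 * (I.horizon : ℝ) + τ i) * R i -
        ∑ j ∈ Finset.range I.numArms, min (R i * τ j) (R j * τ i))) +
          (2 * (I.horizon : ℝ) + τ i) * R i) ?_ fun s₂ ha₂ h8' => ?_
    · refine Prog.achieves_of_exec rfl (by decide) ?_
      simp only [Prog.exec, Store.setReal, RealExpr.eval, NatExpr.eval, hi', hs'.root_eq,
        hs'.horizon, ha.real 3 rfl, ha.real 4 rfl, ha₁.real 3 rfl, ha₁.real 4 rfl, hR i hi, hτ i hi,
        hinv]
      simp
    have hs₂ : Ready I s₂ := hs'.of_agree ha₂ rfl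
    refine (Prog.achieves_forLoop (m := I.numArms) (b := 100 * scale I ^ 0)
      (fun m s'' => s''.real 8 0 = (∑ i ∈ Finset.range i,
        ((2 * (I.horizon : ℝ) + τ i) * R i -
          ∑ j ∈ Finset.range I.numArms, min (R i * τ j) (R j * τ i))) +
            ((2 * (I.horizon : ℝ) + τ i) * R i -
              ∑ j ∈ Finset.range m, min (R i * τ j) (R j * τ i))) rfl ?_ ?_ ?_).mono ?_ ?_
    · intro s'' ha'
      simp only [NatExpr.eval, ha'.nat 0 rfl, hs₂.arms_eq]
    · simpa [Store.setNat] using h8'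
    · intro j hj s'' ha' hinv' hj'
      have hs'' : Ready I s'' := hs₂.of_agree ha' rfl
      have h16 : s''.nat 16 0 = i := by rw [ha'.nat 16 rfl, ha₂.nat 16 rfl, hi']
      refine Prog.achieves_of_exec rfl (by rw [pow_zero]; decide) ?_
      simp only [lossStep, Prog.exec, Test.Holds, RealExpr.eval, NatExpr.eval, hj', h16,
        hs''.root_eq, ha'.real 3 rfl, ha'.real 4 rfl, ha₂.real 3 rfl, ha₂.real 4 rfl,
        ha.real 3 rfl, ha.real 4 rfl, ha₁.real 3 rfl, ha₁.real 4 rfl, hR i hi, hτ i hi,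
        hR j hj, hτ j hj, hinv', Finset.sum_range_succ]
      split_ifs with hle
      · rw [min_eq_left hle]
        simp [Store.setReal, Store.setNat]
        ring
      · rw [min_eq_right (not_le.1 hle).le]
        simp [Store.setReal, Store.setNat]
        ring
    · exact (Prog.loop_cost_le (d := 0) hn one_le_scale le_rfl).trans
        (Nat.mul_le_mul_right _ (by decide))
    · intro s₃ _ h
      exact h.trans (Finset.sum_range_succ _ _).symm
  · exact (Prog.loop_cost_le (d := 1) hn one_le_scale le_rfl).trans
      (Nat.mul_le_mul_right _ (by decide))

lemma keepProg_spec {s : Store} (hs : Ready I s) :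
    keepProg.Achieves s (200 * scale I ^ 1) fun s' =>
      (s.real 8 0 ≤ s.real 9 0 ∧ s'.real 9 0 = s.real 9 0 ∧ s'.nat 18 0 = s.nat 18 0 ∧
        s'.real 10 = s.real 10) ∨
      (s.real 9 0 ≤ s.real 8 0 ∧ s'.real 9 0 = s.real 8 0 ∧ s'.nat 18 0 = s.nat 8 0 ∧
        ∀ i < I.numArms, s'.real 10 i = s.real 3 (I.rootCode i) / s.real 4 (I.rootCode i)) := by
  have hS : 1 ≤ scale I ^ 1 := Nat.one_le_pow _ _ one_le_scale
  have hn : I.numArms ≤ scale I := by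
    have := numArms_le_totalStates (I := I)
    unfold scale
    omega
  refine Prog.Achieves.mono (b := 6 + (20 + 150 * scale I ^ 1)) ?_ (by omega) fun _ _ h => h
  refine Prog.Achieves.ite (fun hle => ?_) fun hlt => ?_
  · refine Prog.achieves_of_exec rfl (le_trans (by decide : _ ≤ 20) (Nat.le_add_right _ _)) ?_
    exact .inl ⟨hle, rfl, rfl, rfl⟩
  refine Prog.Achieves.seq (Q := fun s' => s'.real 9 0 = s.real 8 0 ∧ s'.nat 18 0 = s.nat 8 0) ?_
    fun s₁ ha₁ h₁ => ?_
  · refine Prog.achieves_of_exec rfl (by decide) ?_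
    simp [Prog.exec, Store.setReal, Store.setNat, RealExpr.eval, NatExpr.eval]
  have hs₁ : Ready I s₁ := hs.of_agree ha₁ rfl
  refine (Prog.achieves_forLoop (m := I.numArms) (b := 50 * scale I ^ 0)
    (fun m s' => ∀ i < m, s'.real 10 i = s.real 3 (I.rootCode i) / s.real 4 (I.rootCode i))
    rfl ?_ ?_ ?_).mono ?_ ?_
  · intro s' ha
    simp only [NatExpr.eval, ha.nat 0 rfl, hs₁.arms_eq]
  · simp
  · intro j hj s' ha hinv hi
    have hs' : Ready I s' := hs₁.of_agree ha rfl
    refine Prog.achieves_of_exec rfl (by rw [pow_zero]; decide) ?_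
    intro i hij
    simp only [Prog.exec, Store.setReal, Store.setNat, RealExpr.eval, NatExpr.eval, hi,
      hs'.root_eq, ha.real 3 rfl, ha.real 4 rfl, ha₁.real 3 rfl, ha₁.real 4 rfl]
    by_cases h : i = j
    · simp [h]
    · simp [h, hinv i (by omega)]
  · exact (Prog.loop_cost_le (d := 0) hn one_le_scale le_rfl).trans
      (Nat.mul_le_mul_right _ (by decide))
  · intro s' ha h
    refine .inr ⟨(not_le.1 hlt).le, ?_, ?_, h⟩
    · rw [ha.real 9 rfl, h₁.1]
    · rw [ha.nat 18 rfl, h₁.2]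

/-- The state of the planning program after `c` stages. -/
structure PlanInv (I : Instance.{u}) (c : ℕ) (s : Store) : Prop where
  ready : Ready I s
  order_le : ∀ p, s.nat 7 p ≤ c
  lastReward : ∀ g < I.totalStates, s.real 3 (I.horizon * I.totalStates + g) = 0
  lastPlays : ∀ g < I.totalStates, s.real 4 (I.horizon * I.totalStates + g) = 0
  greedy : ∀ c' < c, I.chain.GreedyStep (s.nat 7) c'
  score_le : ∀ c' < c, I.ruleScore (I.chain.stage (s.nat 7) c') ≤ s.real 9 0
  best_le : s.nat 18 0 ≤ c
  best : s.real 9 0 = I.ruleScore (I.chain.stage (s.nat 7) (s.nat 18 0))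
  index : ∀ i < I.numArms, s.real 10 i = I.armReward (I.chain.stage (s.nat 7) (s.nat 18 0)) i /
    I.armPlays (I.chain.stage (s.nat 7) (s.nat 18 0)) i

lemma PlanInv.setNat {c : ℕ} {s : Store} (h : PlanInv I c s) (v : ℕ) :
    PlanInv I c (s.setNat 8 0 v) := by
  obtain ⟨⟨h1, h2, h3, h4, h5, h6⟩, h7, h8, h9, h10, h11, h12, h13, h14⟩ := h
  have e : ∀ a ≠ 8, (s.setNat 8 0 v).nat a = s.nat a := fun a ha =>
    funext fun j => by simp [Store.setNat, ha]
  refine ⟨⟨?_, ?_, h3, h4, ?_, h6⟩, ?_, h8, h9, ?_, ?_, ?_, ?_, ?_⟩ <;>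
    simp only [e 0 (by decide), e 2 (by decide), e 6 (by decide), e 7 (by decide),
      e 18 (by decide)] <;> assumption

/-- One stage of the planning program. -/
lemma stage_spec {c : ℕ} {s : Store} (h : PlanInv I c s) (h8 : s.nat 8 0 = c) :
    (Prog.seq sweepProg (.seq scoreProg (.seq keepProg addProg))).Achieves s (1100 * scale I ^ 3)
      (PlanInv I (c + 1)) := by
  set C := I.chain.stage (s.nat 7) c with hCdef
  have hC : ∀ k < I.horizon, ∀ g < I.totalStates,
      (C k g ↔ 1 ≤ s.nat 7 (k * I.totalStates + g)) := fun k _ g _ =>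
    and_iff_left (h.order_le _)
  have hS : 1 ≤ scale I := one_le_scale
  have hcost : 500 * scale I ^ 3 + (300 * scale I ^ 2 + (200 * scale I ^ 1 + 30)) ≤
      1100 * scale I ^ 3 := by
    have h1 : scale I ^ 1 ≤ scale I ^ 3 := Nat.pow_le_pow_right hS (by decide)
    have h2 : scale I ^ 2 ≤ scale I ^ 3 := Nat.pow_le_pow_right hS (by decide)
    have h3 : 1 ≤ scale I ^ 3 := Nat.one_le_pow _ _ hS
    omega
  refine Prog.Achieves.mono (Q := PlanInv I (c + 1)) ?_ hcost fun _ _ h => h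
  refine (sweepProg_spec h.ready hC h.lastReward h.lastPlays).seq fun s₁ ha₁ hsweep => ?_
  have hs₁ : Ready I s₁ := h.ready.of_agree ha₁ rfl
  have hdone : ∀ k ≤ I.horizon, ∀ g < I.totalStates, I.chain.Done I.horizon 0 k g :=
    fun k hk g hg => ⟨hk, hg, .inl (Nat.le_add_left _ _)⟩
  have hR : ∀ i < I.numArms, s₁.real 3 (I.rootCode i) = I.armReward C i := fun i hi => by
    have := hsweep.reward 0 (I.rootCode i)
      (hdone 0 (Nat.zero_le _) _ (Instance.rootCode_lt ⟨i, hi⟩))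
    rwa [zero_mul, zero_add] at this
  have hτ : ∀ i < I.numArms, s₁.real 4 (I.rootCode i) = I.armPlays C i := fun i hi => by
    have := hsweep.plays 0 (I.rootCode i)
      (hdone 0 (Nat.zero_le _) _ (Instance.rootCode_lt ⟨i, hi⟩))
    rwa [zero_mul, zero_add] at this
  refine (scoreProg_spec hs₁ hR hτ).seq fun s₂ ha₂ hscore => ?_
  have hs₂ : Ready I s₂ := hs₁.of_agree ha₂ rfl
  change s₂.real 8 0 = I.ruleScore C at hscore
  refine (keepProg_spec hs₂).seq fun s₃ ha₃ hkeep => ?_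
  have hs₃ : Ready I s₃ := hs₂.of_agree ha₃ rfl
  have h7 : s₃.nat 7 = s.nat 7 := by rw [ha₃.nat 7 rfl, ha₂.nat 7 rfl, ha₁.nat 7 rfl]
  have h15 : s₃.nat 15 = s₁.nat 15 := by rw [ha₃.nat 15 rfl, ha₂.nat 15 rfl]
  have h8₃ : s₃.nat 8 0 = c := by rw [ha₃.nat 8 rfl, ha₂.nat 8 rfl, ha₁.nat 8 rfl, h8]
  refine (Prog.achieves_of_exec (Q := fun s' => s'.nat 7 = (fun p =>
    if p = s₁.nat 15 0 ∧ s.nat 7 (s₁.nat 15 0) = 0 then c + 1 else s.nat 7 p)) rfl (by decide)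
    ?_).mono le_rfl fun s₄ ha₄ h7₄ => ?_
  · funext p
    simp only [addProg, Prog.exec, Test.Holds, NatExpr.eval, h15, h7, h8₃]
    by_cases h0 : s.nat 7 (s₁.nat 15 0) = 0
    · simp [h0, Store.setNat, h7]
    · simp [Nat.one_le_iff_ne_zero, h0, h7]
  have hst : ∀ c' ≤ c, I.chain.stage (s₄.nat 7) c' = I.chain.stage (s.nat 7) c' :=
    fun c' hc' => by rw [h7₄, Chain.stage_record hc']
  have h9 : s₄.real 9 0 = s₃.real 9 0 := by rw [ha₄.real 9 rfl]
  have h10 : s₄.real 10 = s₃.real 10 := ha₄.real 10 rfl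
  have h18 : s₄.nat 18 = s₃.nat 18 := ha₄.nat 18 rfl
  have h9' : s₂.real 9 0 = s.real 9 0 := by rw [ha₂.real 9 rfl, ha₁.real 9 rfl]
  have h10' : s₂.real 10 = s.real 10 := by rw [ha₂.real 10 rfl, ha₁.real 10 rfl]
  have h18' : s₂.nat 18 = s.nat 18 := by rw [ha₂.nat 18 rfl, ha₁.nat 18 rfl]
  have h8' : s₂.nat 8 0 = c := by rw [ha₂.nat 8 rfl, ha₁.nat 8 rfl, h8]
  have hlast : ∀ g < I.totalStates,
      I.chain.Done I.horizon 0 I.horizon g ∧ ∀ w, I.chain.total C w I.horizon g = 0 :=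
    fun g hg => ⟨hdone _ le_rfl g hg, fun w => Chain.total_horizon (M := I.chain) le_rfl⟩
  have hbest : s₃.nat 18 0 ≤ c ∧
      (∀ c' < c + 1, I.ruleScore (I.chain.stage (s.nat 7) c') ≤ s₃.real 9 0) ∧
      s₃.real 9 0 = I.ruleScore (I.chain.stage (s.nat 7) (s₃.nat 18 0)) ∧
      ∀ i < I.numArms, s₃.real 10 i = I.armReward (I.chain.stage (s.nat 7) (s₃.nat 18 0)) i /
        I.armPlays (I.chain.stage (s.nat 7) (s₃.nat 18 0)) i := by
    rcases hkeep with ⟨k1, k2, k3, k4⟩ | ⟨k1, k2, k3, k4⟩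
    · rw [k2, k3, k4, h9', h10', h18']
      rw [h9', hscore] at k1
      refine ⟨h.best_le, fun c' hc' => ?_, h.best, h.index⟩
      rcases Nat.lt_succ_iff_lt_or_eq.1 hc' with hlt | rfl
      · exact h.score_le c' hlt
      · exact k1
    · rw [k2, k3, h8', hscore]
      rw [h9', hscore] at k1
      refine ⟨le_rfl, fun c' hc' => ?_, rfl, fun i hi => ?_⟩
      · rcases Nat.lt_succ_iff_lt_or_eq.1 hc' with hlt | rfl
        · exact (h.score_le c' hlt).trans k1
        · exact le_rfl
      · rw [k4 i hi, ha₂.real 3 rfl, ha₂.real 4 rfl, hR i hi, hτ i hi]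
  have hstb := hst _ hbest.1
  exact
    { ready := hs₃.of_agree ha₄ rfl
      order_le := fun p => by
        rw [h7₄]
        dsimp only
        split_ifs
        · exact le_rfl
        · exact (h.order_le p).trans c.le_succ
      lastReward := fun g hg => by
        rw [ha₄.real 3 rfl, ha₃.real 3 rfl, ha₂.real 3 rfl, hsweep.reward _ _ (hlast g hg).1,
          (hlast g hg).2]
      lastPlays := fun g hg => by
        rw [ha₄.real 4 rfl, ha₃.real 4 rfl, ha₂.real 4 rfl, hsweep.plays _ _ (hlast g hg).1,
          (hlast g hg).2]
      greedy := fun c' hc' => by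
        rcases Nat.lt_succ_iff_lt_or_eq.1 hc' with hlt | rfl
        · exact (h.greedy c' hlt).congr (hst c' hlt.le) (hst (c' + 1) hlt)
        · rw [h7₄]
          exact hsweep.chosen.greedyStep Instance.chain_valid h.order_le
            fun k hk g hg => ⟨hk, hdone k hk.le g hg⟩
      score_le := fun c' hc' => by
        rw [hst c' (Nat.le_of_lt_succ hc'), h9]
        exact hbest.2.1 c' hc'
      best_le := by rw [h18]; exact hbest.1.trans c.le_succ
      best := by rw [h9, h18, hstb]; exact hbest.2.2.1
      index := fun i hi => by rw [h10, h18, hstb]; exact hbest.2.2.2 i hi }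

lemma stages_le_scale_sq : I.horizon * I.totalStates + 1 ≤ scale I ^ 2 := by
  unfold scale
  generalize I.horizon = a, I.totalStates = b
  have : (a + b + 1) ^ 2 = a * b + 1 + (a * a + b * b + a * b + 2 * a + 2 * b) := by ring
  omega

lemma score_zero (n : ℕ) (T : ℝ) : score n T (fun _ => 0) (fun _ => 0) = 0 := by
  simp [score]

/-- The planning program runs in polynomial time and finds the greedy stage of largest score. -/
theorem plan_spec : plan.Achieves I.input (1500 * scale I ^ 5)
    (PlanInv I (I.horizon * I.totalStates + 1)) := by
  have hS : 1 ≤ scale I := one_le_scale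
  have hcost : 100 * scale I ^ 1 + (100 * scale I ^ 1 + 1200 * scale I ^ 5) ≤
      1500 * scale I ^ 5 := by
    have h1 : scale I ^ 1 ≤ scale I ^ 5 := Nat.pow_le_pow_right hS (by decide)
    omega
  refine Prog.Achieves.mono (Q := PlanInv I (I.horizon * I.totalStates + 1)) ?_ hcost
    fun _ _ h => h
  refine (rowsProg_spec (fun _ => rfl) rfl).seq fun s₁ ha₁ hrows => ?_
  refine (realHorizonProg_spec (fun j => by rw [ha₁.nat 0 rfl]) (by rw [ha₁.real 2 rfl]; rfl)).seq
    fun s₂ ha₂ hT => ?_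
  have hzero : ∀ a, 3 ≤ a → I.input.nat a = 0 ∧ I.input.real a = 0 := by
    intro a ha
    constructor <;> funext j
    · match a, ha with
      | a + 3, _ => rfl
    · match a, ha with
      | a + 3, _ => rfl
  have hs₂ : Ready I s₂ :=
    { dims := by rw [ha₂.nat 0 rfl, ha₁.nat 0 rfl]
      roots := by rw [ha₂.nat 2 rfl, ha₁.nat 2 rfl]
      reward := by rw [ha₂.real 0 rfl, ha₁.real 0 rfl]
      trans := by rw [ha₂.real 1 rfl, ha₁.real 1 rfl]
      rows := fun j hj => by rw [ha₂.nat 6 rfl, hrows j hj]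
      horizon := hT }
  have h7 : s₂.nat 7 = 0 := by rw [ha₂.nat 7 rfl, ha₁.nat 7 rfl, (hzero 7 (by decide)).1]
  have h18 : s₂.nat 18 = 0 := by rw [ha₂.nat 18 rfl, ha₁.nat 18 rfl, (hzero 18 (by decide)).1]
  have h3 : s₂.real 3 = 0 := by rw [ha₂.real 3 rfl, ha₁.real 3 rfl, (hzero 3 (by decide)).2]
  have h4 : s₂.real 4 = 0 := by rw [ha₂.real 4 rfl, ha₁.real 4 rfl, (hzero 4 (by decide)).2]
  have h9 : s₂.real 9 = 0 := by rw [ha₂.real 9 rfl, ha₁.real 9 rfl, (hzero 9 (by decide)).2]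
  have h10 : s₂.real 10 = 0 := by rw [ha₂.real 10 rfl, ha₁.real 10 rfl, (hzero 10 (by decide)).2]
  have hempty : ∀ w k g, I.chain.total (I.chain.stage 0 0) w k g = 0 := fun w k g =>
    Chain.total_of_not_mem (by simp [Chain.stage])
  have hR : I.armReward (I.chain.stage 0 0) = fun _ => 0 := funext fun j => hempty _ _ _
  have hτ : I.armPlays (I.chain.stage 0 0) = fun _ => 0 := funext fun j => hempty _ _ _
  have h0 : PlanInv I 0 s₂ :=
    { ready := hs₂
      order_le := by simp [h7]
      lastReward := by simp [h3]
      lastPlays := by simp [h4]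
      greedy := by simp
      score_le := by simp
      best_le := by simp [h18]
      best := by
        rw [h9, h7, h18]
        simp only [Pi.zero_apply, Instance.ruleScore, hR, hτ, score_zero]
      index := fun i _ => by
        rw [h10, h7, h18]
        simp only [Pi.zero_apply, hR, hτ, div_zero] }
  refine (Prog.achieves_forLoop (m := I.horizon * I.totalStates + 1) (b := 1100 * scale I ^ 3)
    (PlanInv I) rfl ?_ (h0.setNat 0) ?_).mono ?_ fun _ _ h => h
  · intro s' ha
    simp only [NatExpr.eval, ha.nat 0 rfl, ha.nat 6 rfl, hs₂.horizon_eq,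
      hs₂.rows I.horizon (by omega)]
  · intro c _ s' _ hinv hi
    exact (stage_spec hinv hi).mono le_rfl fun s'' _ h => h.setNat (c + 1)
  · have h1 : I.horizon * I.totalStates + 1 ≤ scale I ^ 2 := stages_le_scale_sq
    have h2 : 1 ≤ scale I ^ 3 := Nat.one_le_pow _ _ hS
    have h3 : 1 ≤ scale I ^ 5 := Nat.one_le_pow _ _ hS
    have h4 : scale I ^ 5 = scale I ^ 2 * scale I ^ 3 := by ring
    have h5 := Nat.mul_le_mul h1 (show 1100 * scale I ^ 3 + 5 + 12 ≤ 1117 * scale I ^ 3 by omega)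
    have h6 : scale I ^ 2 * (1117 * scale I ^ 3) = 1117 * scale I ^ 5 := by rw [h4]; ring
    change (I.horizon * I.totalStates + 1) * (1100 * scale I ^ 3 + 5 + 12) + 5 + 9 ≤ _
    omega

/-! ### The decision program -/

/-- Compare the index of one arm with the best one, if the arm is not stopped. -/
def armStep : Prog :=
  .seq (.assignNat 12 (.lit 0) (.add (row (.get 4 (var 16))) (.get 3 (var 16))))
    (.ite (.conj (.natLe (.lit 1) (.get 7 (var 12)))
        (.conj (.natLe (.get 7 (var 12)) (var 18))
          (.neg (.realLe (.get 10 (var 16)) (rvar 11)))))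
      (.seq (.assignNat 5 (.lit 0) (.add (var 16) (.lit 1)))
        (.assignReal 11 (.lit 0) (.get 10 (var 16)))) .skip)

/-- The decision algorithm: play the arm of largest index among those that are not stopped. -/
def act : Prog :=
  .seq (.seq (.assignNat 5 (.lit 0) (.lit 0)) (.assignReal 11 (.lit 0) (.lit (-1))))
    (.forLoop 16 armsE armStep)

/-- The decision program runs in polynomial time and follows the indices. -/
theorem act_spec {s : Store} {c : ℕ} (h : PlanInv I c s) {x : I.Position}
    (hx : ∑ i, (x i).2 < I.horizon) :
    act.Achieves (I.present s x) (1500 * scale I ^ 5) fun s' =>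
      ∃ d, s'.nat 5 0 = I.decisionCode d ∧
        I.IndexChoice (I.chain.stage (s.nat 7) (s.nat 18 0))
          (fun j => I.armReward (I.chain.stage (s.nat 7) (s.nat 18 0)) j /
            I.armPlays (I.chain.stage (s.nat 7) (s.nat 18 0)) j) x d := by
  set C := I.chain.stage (s.nat 7) (s.nat 18 0) with hC
  set κ : ℕ → ℝ := fun j => I.armReward C j / I.armPlays C j with hκ
  have hκ0 : ∀ i : Fin I.numArms, 0 ≤ κ i := fun i =>
    div_nonneg (Instance.armReward_nonneg C i) (Instance.armPlays_nonneg C i)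
  have hn : I.numArms ≤ scale I := by
    have := numArms_le_totalStates (I := I)
    unfold scale
    omega
  let free : Fin I.numArms → Prop := fun j => C (x j).2 (I.code j (x j).1)
  have hcost : 20 + 150 * scale I ^ 1 ≤ 1500 * scale I ^ 5 := by
    have h1 : scale I ^ 1 ≤ scale I ^ 5 := Nat.pow_le_pow_right one_le_scale (by decide)
    have h2 : 1 ≤ scale I ^ 5 := Nat.one_le_pow _ _ one_le_scale
    omega
  let Inv : ℕ → Store → Prop := fun m s' =>
    (s'.nat 5 0 = 0 ∧ s'.real 11 0 = -1 ∧ ∀ j : Fin I.numArms, (j : ℕ) < m → ¬ free j) ∨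
    ∃ i : Fin I.numArms, (i : ℕ) < m ∧ s'.nat 5 0 = i + 1 ∧ s'.real 11 0 = κ i ∧ free i ∧
      ∀ j : Fin I.numArms, (j : ℕ) < m → free j → κ j ≤ κ i ∧ (j < i → κ j < κ i)
  refine Prog.Achieves.mono (b := 20 + 150 * scale I ^ 1) (Q := Inv I.numArms) ?_ hcost ?_
  swap
  · rintro s' - (⟨h5, -, hfree⟩ | ⟨i, -, h5, -, hi, hmax⟩)
    · exact ⟨none, h5, .inl ⟨rfl, fun j => hfree j j.isLt⟩⟩
    · exact ⟨some i, h5, .inr ⟨i, rfl, hi, fun j hj => hmax j j.isLt hj⟩⟩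
  refine Prog.Achieves.seq (Q := fun s' => s'.nat 5 0 = 0 ∧ s'.real 11 0 = -1) ?_
    fun s₁ ha₁ h₁ => ?_
  · refine Prog.achieves_of_exec rfl (by decide) ?_
    simp [Prog.exec, Store.setReal, Store.setNat, RealExpr.eval, NatExpr.eval]
  refine (Prog.achieves_forLoop (m := I.numArms) (b := 100 * scale I ^ 0) Inv rfl ?_ ?_ ?_).mono
    ?_ fun _ _ h => h
  · intro s' ha
    simp only [NatExpr.eval, ha.nat 0 rfl, ha₁.nat 0 rfl]
    exact h.ready.arms_eq
  · exact .inl ⟨by simpa [Store.setNat] using h₁.1, h₁.2, fun j hj => absurd hj (Nat.not_lt_zero _)⟩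
  · intro m hm s' ha hinv hi
    set i : Fin I.numArms := ⟨m, hm⟩ with hidef
    have h3 : s'.nat 3 m = I.code i (x i).1 := by
      rw [ha.nat 3 rfl, ha₁.nat 3 rfl]
      exact dif_pos hm
    have h4 : s'.nat 4 m = (x i).2 := by
      rw [ha.nat 4 rfl, ha₁.nat 4 rfl]
      exact dif_pos hm
    have h6 : s'.nat 6 (x i).2 = (x i).2 * I.totalStates := by
      rw [ha.nat 6 rfl, ha₁.nat 6 rfl]
      exact h.ready.rows _ ((Instance.lt_horizon_of_sum hx i).le.trans (Nat.le_add_right _ _))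
    have h7 : s'.nat 7 = s.nat 7 := by rw [ha.nat 7 rfl, ha₁.nat 7 rfl]; rfl
    have h18 : s'.nat 18 0 = s.nat 18 0 := by rw [ha.nat 18 rfl, ha₁.nat 18 rfl]; rfl
    have h10 : s'.real 10 m = κ i := by
      rw [ha.real 10 rfl, ha₁.real 10 rfl]; exact h.index m hm
    have hfree : free i ↔ 1 ≤ s.nat 7 ((x i).2 * I.totalStates + I.code i (x i).1) ∧
        s.nat 7 ((x i).2 * I.totalStates + I.code i (x i).1) ≤ s.nat 18 0 := Iff.rfl
    have hlast : ∀ j : Fin I.numArms, (j : ℕ) < m + 1 → (j : ℕ) < m ∨ j = i := fun j hj =>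
      (Nat.lt_succ_iff_lt_or_eq.1 hj).imp_right fun h => Fin.ext h
    refine Prog.Achieves.mono (b := 20 + 50) (Q := fun s'' => Inv (m + 1) (s''.setNat 16 0 (m + 1)))
      ?_ (by rw [pow_zero]; decide) fun _ _ h => h
    refine Prog.Achieves.seq (Q := fun s'' =>
      s''.nat 12 0 = (x i).2 * I.totalStates + I.code i (x i).1) ?_ fun s₂ ha₂ h12 => ?_
    · refine Prog.achieves_of_exec rfl (by decide) ?_
      simp [Prog.exec, NatExpr.eval, Store.setNat, hi, h3, h4, h6]
    replace hi : s₂.nat 16 0 = m := by rw [ha₂.nat 16 rfl, hi]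
    replace h10 : s₂.real 10 m = κ i := by rw [ha₂.real 10 rfl, h10]
    replace hinv : Inv m s₂ := by
      simp only [Inv] at hinv ⊢
      rwa [ha₂.nat 5 rfl, ha₂.real 11 rfl]
    refine Prog.achieves_of_exec rfl (by decide) ?_
    have htest : (Test.conj (.natLe (.lit 1) (.get 7 (var 12)))
        (.conj (.natLe (.get 7 (var 12)) (var 18))
          (.neg (.realLe (.get 10 (var 16)) (rvar 11))))).Holds s₂ ↔
        free i ∧ s₂.real 11 0 < κ i := by
      simp only [Test.Holds, NatExpr.eval, RealExpr.eval, h12, hi, ha₂.nat 7 rfl, h7,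
        ha₂.nat 18 rfl, h18, h10, hfree, not_le, and_assoc]
    simp only [Prog.exec]
    split_ifs with hb <;> rw [htest] at hb
    · refine .inr ⟨i, Nat.lt_succ_self m, ?_, ?_, hb.1, fun j hj hfj => ?_⟩
      · simp [NatExpr.eval, Store.setNat, Store.setReal, hi, hidef]
      · simpa [RealExpr.eval, NatExpr.eval, Store.setNat, Store.setReal, hi] using h10
      · rcases hlast j hj with hj' | rfl
        · have hlt : κ j < κ i := by
            rcases hinv with ⟨-, -, hnone⟩ | ⟨i', -, -, h11, -, hmax⟩
            · exact absurd hfj (hnone j hj')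
            · exact ((hmax j hj' hfj).1.trans_eq h11.symm).trans_lt hb.2
          exact ⟨hlt.le, fun _ => hlt⟩
        · exact ⟨le_rfl, fun h => absurd h (lt_irrefl _)⟩
    · rcases hinv with ⟨h5, h11, hnone⟩ | ⟨i', hi', h5, h11, hfi', hmax⟩
      · refine .inl ⟨by simpa [Store.setNat] using h5, h11, fun j hj hfj => ?_⟩
        rcases hlast j hj with hj' | rfl
        · exact hnone j hj' hfj
        · refine hb ⟨hfj, ?_⟩
          rw [h11]
          linarith [hκ0 i]
      · refine .inr ⟨i', hi'.trans (Nat.lt_succ_self m), by simpa [Store.setNat] using h5, h11,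
          hfi', fun j hj hfj => ?_⟩
        rcases hlast j hj with hj' | rfl
        · exact hmax j hj' hfj
        · refine ⟨?_, fun hlt => absurd hlt (not_lt.2 (Fin.le_def.2 hi'.le))⟩
          by_contra hgt
          exact hb ⟨hfj, by rw [h11]; exact not_le.1 hgt⟩
  · exact (Prog.loop_cost_le (d := 0) hn one_le_scale le_rfl).trans
      (Nat.mul_le_mul_right _ (by decide))

end Program

end BayesBandit

theorem theorem2 :
    ∃ (plan act : BayesBandit.Prog) (q : Polynomial ℕ),
      ∀ I : BayesBandit.Instance.{u},
        ∃ (s : BayesBandit.Store) (c : ℕ) (π : I.Policy),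
          plan.Runs I.input s c ∧
          c ≤ q.eval (I.horizon + I.totalStates) ∧
          I.Executes act s (q.eval (I.horizon + I.totalStates)) π ∧
          I.optimum / 2 ≤ I.value π := by
  classical
  refine ⟨BayesBandit.Program.plan, BayesBandit.Program.act,
    Polynomial.C 1500 * (Polynomial.X + 1) ^ 5, fun I => ?_⟩
  have hq : (Polynomial.C 1500 * (Polynomial.X + 1) ^ 5).eval (I.horizon + I.totalStates) =
      1500 * BayesBandit.Program.scale I ^ 5 := by
    simp [BayesBandit.Program.scale]
  rw [hq]
  obtain ⟨s, c, hrun, hc, hs⟩ := BayesBandit.Program.plan_spec (I := I)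
  have hact : ∀ x : I.Position, ∃ d, ∑ i, (x i).2 < I.horizon →
      (∃ (s' : BayesBandit.Store) (c : ℕ),
        BayesBandit.Program.act.Runs (I.present s x) s' c ∧
        c ≤ 1500 * BayesBandit.Program.scale I ^ 5 ∧ s'.nat 5 0 = I.decisionCode d) ∧
      I.IndexChoice (I.chain.stage (s.nat 7) (s.nat 18 0))
        (fun j => I.armReward (I.chain.stage (s.nat 7) (s.nat 18 0)) j /
          I.armPlays (I.chain.stage (s.nat 7) (s.nat 18 0)) j) x d := by
    intro x
    by_cases hx : ∑ i, (x i).2 < I.horizon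
    · obtain ⟨s', c', hr, hc', d, hd, hchoice⟩ := BayesBandit.Program.act_spec hs hx
      exact ⟨d, fun _ => ⟨⟨s', c', hr, hc', hd⟩, hchoice⟩⟩
    · exact ⟨none, fun h => absurd h hx⟩
  choose π hπ using hact
  refine ⟨s, c, π, hrun, hc, fun x hx => (hπ x hx).1,
    BayesBandit.Instance.optimum_div_two_le_value (fun c' hc' => hs.greedy c' ?_)
      (fun c' hc' => ?_) fun x hx => (hπ x hx).2⟩
  · exact Nat.lt_succ_of_lt hc'
  · exact (hs.score_le c' (Nat.lt_succ_of_le hc')).trans_eq hs.best
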